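/- Let $\mathbb{Q}_\varepsilon:=\mathbb{Q}[\varepsilon]$, and let $\mathbb{D}$ be the $\mathbb{Q}_\varepsilon[[h]]$-algebra topologically generated by $\mathbf{y},\mathbf{t},\mathbf{a},\mathbf{x}$ (that is, the quotient of $\mathbb{Q}_\varepsilon\langle \mathbf{y},\mathbf{t},\mathbf{a},\mathbf{x}\rangle[[h]]$ by the $h$-adic closure of the two-sided ideal generated by the relations) subject to $$[\mathbf{t},-]=0,\qquad [\mathbf{a},\mathbf{x}]=\mathbf{x},\qquad [\mathbf{a},\mathbf{y}]=-\mathbf{y},\qquad \mathbf{x}\mathbf{y}-q\,\mathbf{y}\mathbf{x}=\frac{1-\mathbf{A}^2\mathbf{T}}{h},$$ where $q=e^{h\varepsilon}$, $\mathbf{A}=e^{-h\varepsilon\mathbf{a}}$, $\mathbf{T}=e^{-h\mathbf{t}}$. All completed tensor products $\hat\otimes$ are $h$-adic completions of tensor products over $\mathbb{Q}_\varepsilon[[h]]$. Let $\Delta:\mathbb{D}\to\mathbb{D}\hat\otimes\mathbb{D}$ be the algebra homomorphism and $S:\mathbb{D}\to\mathbb{D}$ the algebra antihomomorphism with $$\Delta(\mathbf{y})=1\otimes\mathbf{y}+\mathbf{y}\otimes\mathbf{T}\mathbf{A},\quad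 \Delta(\mathbf{t})=\mathbf{t}\otimes1+1\otimes\mathbf{t},\quad \Delta(\mathbf{a})=\mathbf{a}\otimes1+1\otimes\mathbf{a},\quad \Delta(\mathbf{x})=1\otimes\mathbf{x}+\mathbf{x}\otimes\mathbf{A},$$ $$S(\mathbf{y})=-\mathbf{y}(\mathbf{T}\mathbf{A})^{-1},\quad S(\mathbf{t})=-\mathbf{t},\quad S(\mathbf{a})=-\mathbf{a},\quad S(\mathbf{x})=-\mathbf{x}\mathbf{A}^{-1}.$$ Put $\kappa=+\sqrt{\mathbf{A}^2\mathbf{T}}=e^{-h(\varepsilon\mathbf{a}+\mathbf{t}/2)}$, $\mathbf{b}=\mathbf{t}+\varepsilon\mathbf{a}$, $[m]_q!=\prod_{i=1}^m\frac{1-q^i}{1-q}$, and $$R=\sum_{m,n\ge0}\frac{h^{m+n}}{[m]_q!\,n!}\,\mathbf{y}^m\mathbf{b}^n\otimes\mathbf{a}^n\mathbf{x}^m=\sum_i\alpha_i\otimes\beta_i\in\mathbb{D}\hat\otimes\mathbb{D}.$$ Let the band map $B:\mathbb{D}\hat\otimes\mathbb{D}\to\mathbb{D}$ and the cross map $Cr:\mathbb{D}\hat\otimes\mathbb{D}\to\mathbb{D}\hat\otimes\mathbb{D}$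 be the $\mathbb{Q}_\varepsilon[[h]]$-linear maps with $$B(x\otimes y)=\sum x_{(2)}S(y_{(1)})\,\kappa\, S(x_{(1)})\,\kappa\, y_{(2)},\qquad Cr(x\otimes y)=\sum_i x\alpha_i\otimes\beta_iy,$$ where $\Delta(z)=\sum z_{(1)}\otimes z_{(2)}$, and for $g\ge1$ let $Th=\mu^{[g]}\circ B^{\hat\otimes g}\circ Cr^{\hat\otimes g}:\mathbb{D}^{\hat\otimes 2g}\to\mathbb{D}$ be the algebraic thickening map, where $\mu^{[g]}$ is the $g$-fold multiplication. The ordering map $\mathcal{O}:\mathbb{Q}_\varepsilon[y,t,a,x][[h]]\to\mathbb{D}$, the $\mathbb{Q}_\varepsilon[[h]]$-linear, $h$-adically continuous map with $y^kt^la^px^r\mapsto\mathbf{y}^k\mathbf{t}^l\mathbf{a}^p\mathbf{x}^r$, is a bijection, so that every $u\in\mathbb{D}$ is in a unique way an $h$-adically convergent $\mathbb{Q}$-linear combination of the monomials $\mathbf{y}^k\mathbf{t}^l\mathbf{a}^p\mathbf{x}^r\varepsilon^sh^i$. Moreover: 1. For every $w\in\mathbb{D}\hat\otimes\mathbb{D}$,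 all monomials $\mathbf{y}^k\mathbf{t}^l\mathbf{a}^p\mathbf{x}^r\varepsilon^sh^i$ that occur in $B(w)$ with a non-zero coefficient satisfy $p\le s$. In particular, for all $n\ge0$ and $j\ge1$, $$\mathrm{span}_{\mathbb{Q}[[h]]}\{\mathbf{y}^k\mathbf{t}^l\mathbf{a}^{n+j}\mathbf{x}^r\varepsilon^n : k,l,r\ge0\}\cap\operatorname{im}B=0.$$ 2. For every $g\ge1$, the same two assertions hold with $Th:\mathbb{D}^{\hat\otimes 2g}\to\mathbb{D}$ in place of $B$. -/

import Mathlib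

namespace BandMap

open scoped TensorProduct Nat

/-- The base ring `ℚ[ε]`. -/
abbrev Qe : Type := Polynomial ℚ

/-- The ring `ℚ[ε][[h]]`. -/
abbrev K : Type := PowerSeries Qe

/-- The variable `h`. -/
noncomputable abbrev h : K := PowerSeries.X

/-- The variable `ε`, seen in `ℚ[ε][[h]]`. -/
noncomputable abbrev eps : K := PowerSeries.C Polynomial.X

/-- The ideal `(h)` of `ℚ[ε][[h]]`; all completions are with respect to it. -/
noncomputable abbrev hI : Ideal K := Ideal.span {h}

section Complete

lemma mem_hI_pow {M : Type*} [AddCommGroup M] [Module K M] (n : ℕ) (x : M) :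
    x ∈ (hI ^ n • ⊤ : Submodule K M) ↔ ∃ r : M, x = h ^ n • r := by
  rw [Ideal.span_singleton_pow, Submodule.ideal_span_singleton_smul,
    Submodule.mem_smul_pointwise_iff_exists]
  constructor
  · rintro ⟨r, -, hr⟩
    exact ⟨r, hr.symm⟩
  · rintro ⟨r, hr⟩
    exact ⟨r, trivial, hr.symm⟩

lemma smodEq_iff {M : Type*} [AddCommGroup M] [Module K M] (n : ℕ) (x y : M) :
    x ≡ y [SMOD (hI ^ n • ⊤ : Submodule K M)] ↔ ∃ r : M, x - y = h ^ n • r := by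
  rw [SModEq.sub_mem, mem_hI_pow]

lemma eq_of_forall_h {M : Type*} [AddCommGroup M] [Module K M] [IsAdicComplete hI M]
    {x y : M} (H : ∀ n : ℕ, ∃ r : M, x - y = h ^ n • r) : x = y :=
  (IsHausdorff.eq_iff_smodEq (I := hI)).2 fun n => (smodEq_iff n x y).2 (H n)

lemma exists_h_sum {M : Type*} [AddCommGroup M] [Module K M] [IsAdicComplete hI M]
    (c : ℕ → M) : ∃ s : M, ∀ n : ℕ, ∃ r : M,
      (∑ i ∈ Finset.range n, h ^ i • c i) - s = h ^ n • r := by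
  have hp : IsPrecomplete hI M := inferInstance
  obtain ⟨s, hs⟩ := hp.prec (f := fun n => ∑ i ∈ Finset.range n, h ^ i • c i) (by
    intro m n hmn
    rw [smodEq_iff]
    obtain ⟨k, rfl⟩ := Nat.exists_eq_add_of_le hmn
    refine ⟨-∑ i ∈ Finset.range k, h ^ i • c (m + i), ?_⟩
    rw [Finset.sum_range_add, sub_add_cancel_left, smul_neg, Finset.smul_sum]
    simp only [pow_add, mul_smul])
  exact ⟨s, fun n => (smodEq_iff n _ _).1 (hs n)⟩

lemma isAdicComplete_of {M : Type*} [AddCommGroup M] [Module K M]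
    (sep : ∀ x : M, (∀ n : ℕ, ∃ r : M, x = h ^ n • r) → x = 0)
    (lim : ∀ c : ℕ → M, ∃ s : M, ∀ n : ℕ, ∃ r : M,
      (∑ i ∈ Finset.range n, h ^ i • c i) - s = h ^ n • r) : IsAdicComplete hI M where
  haus' x hx := sep x fun n => by
    simpa using (smodEq_iff n x 0).1 (hx n)
  prec' f hf := by
    have H : ∀ n, ∃ r : M, f (n + 1) - f n = h ^ n • r := fun n => by
      obtain ⟨r, hr⟩ := (smodEq_iff n _ _).1 (hf (Nat.le_succ n))
      exact ⟨-r, by rw [smul_neg, ← hr, neg_sub]⟩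
    choose c hc using H
    obtain ⟨s, hs⟩ := lim c
    refine ⟨s + f 0, fun n => (smodEq_iff n _ _).2 ?_⟩
    obtain ⟨r, hr⟩ := hs n
    refine ⟨r, ?_⟩
    rw [← hr, ← Finset.sum_congr rfl fun i _ => hc i, Finset.sum_range_sub]
    abel

lemma isAdicComplete_congr {M N : Type*} [AddCommGroup M] [Module K M] [AddCommGroup N]
    [Module K N] [IsAdicComplete hI M] (e : M ≃ₗ[K] N) : IsAdicComplete hI N := by
  apply isAdicComplete_of
  · intro x hx
    apply e.symm.injective
    apply eq_of_forall_h
    intro n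
    obtain ⟨r, hr⟩ := hx n
    exact ⟨e.symm r, by rw [map_zero, sub_zero, hr, map_smul]⟩
  · intro c
    obtain ⟨s, hs⟩ := exists_h_sum fun i => e.symm (c i)
    refine ⟨e s, fun n => ?_⟩
    obtain ⟨r, hr⟩ := hs n
    refine ⟨e r, ?_⟩
    rw [← map_smul, ← hr, map_sub, map_sum]
    simp

variable {C : Type*} [Ring C] [Algebra K C] [IsAdicComplete hI C]

/-- The value `∑ cₙ hⁿ` of a power series with coefficients in a complete `ℚ[ε][[h]]`-algebra. -/
noncomputable def hSum (f : PowerSeries C) : C :=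
  Classical.choose (exists_h_sum fun i => PowerSeries.coeff i f)

lemma hSum_spec (f : PowerSeries C) (n : ℕ) : ∃ r : C,
    (∑ i ∈ Finset.range n, h ^ i • PowerSeries.coeff i f) - hSum f = h ^ n • r :=
  Classical.choose_spec (exists_h_sum fun i => PowerSeries.coeff i f) n

lemma hSum_unique (f : PowerSeries C) (s : C) (H : ∀ n : ℕ, ∃ r : C,
    (∑ i ∈ Finset.range n, h ^ i • PowerSeries.coeff i f) - s = h ^ n • r) : hSum f = s := by
  apply eq_of_forall_h
  intro n
  obtain ⟨r, hr⟩ := H n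
  obtain ⟨r', hr'⟩ := hSum_spec f n
  exact ⟨r - r', by rw [smul_sub, ← hr, ← hr']; abel⟩

lemma hSum_map {C' : Type*} [Ring C'] [Algebra K C'] [IsAdicComplete hI C'] (L : C →ₗ[K] C')
    (f : PowerSeries C) (g : PowerSeries C')
    (hg : ∀ n, PowerSeries.coeff n g = L (PowerSeries.coeff n f)) : hSum g = L (hSum f) := by
  apply hSum_unique
  intro n
  obtain ⟨r, hr⟩ := hSum_spec f n
  refine ⟨L r, ?_⟩
  rw [← map_smul, ← hr, map_sub, map_sum]
  simp [hg]

lemma hSum_add (f g : PowerSeries C) : hSum (f + g) = hSum f + hSum g := by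
  apply hSum_unique
  intro n
  obtain ⟨r, hr⟩ := hSum_spec f n
  obtain ⟨r', hr'⟩ := hSum_spec g n
  refine ⟨r + r', ?_⟩
  rw [smul_add, ← hr, ← hr']
  simp only [map_add, smul_add, Finset.sum_add_distrib]
  abel

lemma hSum_C_mul (a : C) (f : PowerSeries C) : hSum (PowerSeries.C a * f) = a * hSum f :=
  hSum_map (LinearMap.mulLeft K a) f _ (by simp)

lemma hSum_X_mul (f : PowerSeries C) : hSum (PowerSeries.X * f) = h • hSum f := by
  apply hSum_unique
  intro n
  cases n with
  | zero => exact ⟨_, by rw [pow_zero, one_smul]⟩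
  | succ n =>
    obtain ⟨r, hr⟩ := hSum_spec f n
    refine ⟨r, ?_⟩
    rw [Finset.sum_range_succ', pow_succ', mul_smul, ← hr, smul_sub, Finset.smul_sum]
    simp [PowerSeries.coeff_succ_X_mul, pow_succ', mul_smul]

lemma hSum_C (a : C) : hSum (PowerSeries.C a) = a := by
  apply hSum_unique
  intro n
  cases n with
  | zero => exact ⟨_, by rw [pow_zero, one_smul]⟩
  | succ n =>
    refine ⟨0, ?_⟩
    rw [Finset.sum_range_succ']
    simp [PowerSeries.coeff_C]

/-- The series `∑ cₙ₊₁ hⁿ`, that is `(f - f(0)) / h`. -/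
noncomputable def shift {R : Type*} [Semiring R] (f : PowerSeries R) : PowerSeries R :=
  PowerSeries.mk fun n => PowerSeries.coeff (n + 1) f

lemma eq_C_add_X_mul_shift {R : Type*} [Semiring R] (f : PowerSeries R) :
    f = PowerSeries.C (PowerSeries.coeff 0 f) + PowerSeries.X * shift f := by
  ext n
  cases n with
  | zero => simp
  | succ n => simp [PowerSeries.coeff_succ_X_mul, shift]

lemma hSum_mul (f g : PowerSeries C) : hSum (f * g) = hSum f * hSum g := by
  apply eq_of_forall_h
  intro n
  induction n generalizing f with
  | zero => exact ⟨_, by rw [pow_zero, one_smul]⟩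
  | succ n ih =>
    obtain ⟨r, hr⟩ := ih (shift f)
    refine ⟨r, ?_⟩
    rw [pow_succ', mul_smul, ← hr]
    conv_lhs => rw [eq_C_add_X_mul_shift f]
    rw [add_mul, hSum_add, hSum_add, mul_assoc, hSum_C_mul, hSum_X_mul, hSum_X_mul, hSum_C,
      add_mul, smul_sub, smul_mul_assoc]
    abel

/-- Evaluation `∑ cₙ Xⁿ ↦ ∑ cₙ hⁿ` as a ring homomorphism. -/
noncomputable def hEval : PowerSeries C →+* C where
  toFun := hSum
  map_one' := by simpa using hSum_C (1 : C)
  map_mul' := hSum_mul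
  map_zero' := by simpa using hSum_C (0 : C)
  map_add' := hSum_add

lemma hEval_apply (f : PowerSeries C) : hEval f = hSum f := rfl

end Complete

section Exp

/-- The series `e^{uX} = ∑ uⁿ Xⁿ / n!`. -/
noncomputable def expSeries {R : Type*} [Ring R] [Algebra ℚ R] (u : R) : PowerSeries R :=
  PowerSeries.mk fun n => ((n ! : ℚ)⁻¹) • u ^ n

variable {R : Type*} [Ring R] [Algebra ℚ R]

lemma expSeries_zero : expSeries (0 : R) = 1 := by
  ext n
  cases n <;> simp [expSeries, PowerSeries.coeff_one]

lemma expSeries_add {u v : R} (huv : Commute u v) :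
    expSeries (u + v) = expSeries u * expSeries v := by
  ext n
  rw [PowerSeries.coeff_mul, expSeries, PowerSeries.coeff_mk, huv.add_pow', Finset.smul_sum]
  apply Finset.sum_congr rfl
  rintro ⟨i, j⟩ hij
  obtain rfl : i + j = n := Finset.HasAntidiagonal.mem_antidiagonal.1 hij
  simp only [expSeries, PowerSeries.coeff_mk]
  rw [smul_mul_smul_comm, ← Nat.cast_smul_eq_nsmul ℚ, smul_smul]
  congr 1
  rw [Nat.choose_symm_add, Nat.add_choose, Nat.cast_div (Nat.factorial_mul_factorial_dvd_factorial_add i j) (by positivity)]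
  have := Nat.factorial_ne_zero (i + j)
  push_cast
  field_simp

lemma C_mul_expSeries {x u w : R} (H : x * u = w * x) :
    PowerSeries.C x * expSeries u = expSeries w * PowerSeries.C x := by
  ext n
  have : SemiconjBy x (u ^ n) (w ^ n) := SemiconjBy.pow_right H n
  simp [expSeries, this.eq]

end Exp

section HExp

variable {C : Type*} [Ring C] [Algebra K C] [Algebra ℚ C] [IsAdicComplete hI C]

/-- The exponential `e^{hu} = ∑ uⁿ hⁿ / n!` in a complete algebra. -/
noncomputable def hExp (u : C) : C := hEval (expSeries u)

/-- The quotient `(1 - e^{hu}) / h`, obtained by dividing the series by `h`. -/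
noncomputable def hQuot (u : C) : C := hEval (shift (1 - expSeries u))

lemma hExp_zero : hExp (0 : C) = 1 := by rw [hExp, expSeries_zero, map_one]

lemma hExp_add {u v : C} (huv : Commute u v) : hExp (u + v) = hExp u * hExp v := by
  rw [hExp, expSeries_add huv, map_mul]; rfl

lemma mul_hExp {x u w : C} (H : x * u = w * x) : x * hExp u = hExp w * x := by
  have := congrArg hEval (C_mul_expSeries H)
  rwa [map_mul, map_mul, hEval_apply (PowerSeries.C x), hSum_C] at this

lemma shift_one_sub_mul {R : Type*} [Ring R] (E E' : PowerSeries R)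
    (hE : PowerSeries.coeff 0 E = 1) (hE' : PowerSeries.coeff 0 E' = 1) :
    shift (1 - E * E') = shift (1 - E') + shift (1 - E) * E' := by
  have key : PowerSeries.X * shift (1 - E * E')
      = PowerSeries.X * (shift (1 - E') + shift (1 - E) * E') := by
    have h1 := eq_C_add_X_mul_shift (1 - E * E')
    have h2 := eq_C_add_X_mul_shift (1 - E')
    have h3 := eq_C_add_X_mul_shift (1 - E)
    have z : PowerSeries.coeff 0 (1 - E * E') = 0 := by
      rw [PowerSeries.coeff_zero_eq_constantCoeff_apply] at hE hE' ⊢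
      rw [map_sub, map_mul, hE, hE']; simp
    have z2 : PowerSeries.coeff 0 (1 - E') = 0 := by rw [map_sub, hE']; simp
    have z3 : PowerSeries.coeff 0 (1 - E) = 0 := by rw [map_sub, hE]; simp
    rw [z, map_zero, zero_add] at h1
    rw [z2, map_zero, zero_add] at h2
    rw [z3, map_zero, zero_add] at h3
    rw [← h1, mul_add, ← h2, ← mul_assoc, ← h3]
    noncomm_ring
  ext n
  have := congrArg (PowerSeries.coeff (n + 1)) key
  simpa only [PowerSeries.coeff_succ_X_mul] using this

lemma coeff_zero_expSeries {R : Type*} [Ring R] [Algebra ℚ R] (u : R) :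
    PowerSeries.coeff 0 (expSeries u) = 1 := by
  rw [expSeries, PowerSeries.coeff_mk]; simp

lemma hQuot_add {u v : C} (huv : Commute u v) :
    hQuot (u + v) = hQuot v + hQuot u * hExp v := by
  rw [hQuot, expSeries_add huv, shift_one_sub_mul _ _ (coeff_zero_expSeries u)
    (coeff_zero_expSeries v), map_add, map_mul]
  rfl

lemma hExp_map {C' : Type*} [Ring C'] [Algebra K C'] [Algebra ℚ C'] [IsAdicComplete hI C']
    (L : C →ₗ[K] C') (u : C) (v : C') (H : ∀ n, L (u ^ n) = v ^ n) : hExp v = L (hExp u) :=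
  hSum_map L _ _ fun n => by
    simp only [expSeries, PowerSeries.coeff_mk, ← H]
    exact (map_rat_smul L _ _).symm

lemma hQuot_map {C' : Type*} [Ring C'] [Algebra K C'] [Algebra ℚ C'] [IsAdicComplete hI C']
    (L : C →ₗ[K] C') (u : C) (v : C') (H : ∀ n, L (u ^ n) = v ^ n) : hQuot v = L (hQuot u) :=
  hSum_map L _ _ fun n => by
    simp only [shift, expSeries, PowerSeries.coeff_mk, map_sub, ← H, map_rat_smul L,
      PowerSeries.coeff_one]
    simp

end HExp

section Extend

variable {M P : Type*} [AddCommGroup M] [Module K M] [AddCommGroup P] [Module K P]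

lemma eq_of_eq_of [IsAdicComplete hI P] {f g : AdicCompletion hI M →ₗ[K] P}
    (H : ∀ x, f (AdicCompletion.of hI M x) = g (AdicCompletion.of hI M x)) : f = g := by
  refine LinearMap.ext fun z => ?_
  apply eq_of_forall_h
  intro n
  obtain ⟨x, hx⟩ := Submodule.Quotient.mk_surjective _ (AdicCompletion.eval hI M n z)
  have : z - AdicCompletion.of hI M x ∈ (hI ^ n • ⊤ : Submodule K (AdicCompletion hI M)) := by
    rw [AdicCompletion.pow_smul_top_eq_ker_eval ⟨{h}, by simp⟩, LinearMap.mem_ker, map_sub, ← hx]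
    simp
  obtain ⟨r, hr⟩ := (mem_hI_pow n _).1 this
  refine ⟨f r - g r, ?_⟩
  rw [smul_sub, ← map_smul, ← map_smul, ← hr, map_sub, map_sub, H]
  abel

/-- The extension of a linear map into a complete module to the completion of its source. -/
noncomputable def extendFun [IsAdicComplete hI P] (f : M →ₗ[K] P) :
    AdicCompletion hI M →ₗ[K] P :=
  (AdicCompletion.ofLinearEquiv hI P).symm.toLinearMap ∘ₗ
    (AdicCompletion.map hI f).restrictScalars K

lemma extendFun_of [IsAdicComplete hI P] (f : M →ₗ[K] P) (x : M) :
    extendFun f (AdicCompletion.of hI M x) = f x := by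
  rw [extendFun, LinearMap.comp_apply, LinearMap.restrictScalars_apply, AdicCompletion.map_of]
  exact AdicCompletion.ofLinearEquiv_symm_of (I := hI) (f x)

/-- `extendFun` as a linear operation: a linear map `M → P` into a complete module extends
uniquely to the `h`-adic completion of `M`. -/
noncomputable def extend [IsAdicComplete hI P] :
    (M →ₗ[K] P) →ₗ[K] (AdicCompletion hI M →ₗ[K] P) where
  toFun f := extendFun f
  map_add' f g := eq_of_eq_of fun x => by simp [extendFun_of]
  map_smul' c f := eq_of_eq_of fun x => by simp [extendFun_of]

@[simp]
lemma extend_of [IsAdicComplete hI P] (f : M →ₗ[K] P) (x : M) :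
    extend f (AdicCompletion.of hI M x) = f x := extendFun_of f x

instance isAdicComplete_completion : IsAdicComplete hI (AdicCompletion hI M) :=
  AdicCompletion.isAdicComplete ⟨{h}, by simp⟩

/-- The unique extension of a bilinear map into a complete module to the completions. -/
noncomputable def extend₂ {N : Type*} [AddCommGroup N] [Module K N] [IsAdicComplete hI P]
    (f : M →ₗ[K] N →ₗ[K] P) : AdicCompletion hI M →ₗ[K] AdicCompletion hI N →ₗ[K] P :=
  (extend (P := P) ∘ₗ (extend (P := P) ∘ₗ f).flip).flip

@[simp]
lemma extend₂_of {N : Type*} [AddCommGroup N] [Module K N] [IsAdicComplete hI P]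
    (f : M →ₗ[K] N →ₗ[K] P) (x : M) (y : N) :
    extend₂ f (AdicCompletion.of hI M x) (AdicCompletion.of hI N y) = f x y := by
  simp [extend₂]

lemma eq_of_eq_of₂ {N : Type*} [AddCommGroup N] [Module K N] [IsAdicComplete hI P]
    {f g : AdicCompletion hI M →ₗ[K] AdicCompletion hI N →ₗ[K] P}
    (H : ∀ x y, f (AdicCompletion.of hI M x) (AdicCompletion.of hI N y)
      = g (AdicCompletion.of hI M x) (AdicCompletion.of hI N y)) (z w) : f z w = g z w := by
  have h1 : ∀ x, f (AdicCompletion.of hI M x) = g (AdicCompletion.of hI M x) :=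
    fun x => eq_of_eq_of fun y => H x y
  have h2 : f.flip w = g.flip w := eq_of_eq_of fun x => by
    rw [LinearMap.flip_apply, LinearMap.flip_apply, h1]
  exact LinearMap.congr_fun h2 z

end Extend

section CompletedAlgebra

variable (A : Type*) [Ring A] [Algebra K A]

/-- The multiplication of the completion of an algebra. -/
noncomputable def cMul :
    AdicCompletion hI A →ₗ[K] AdicCompletion hI A →ₗ[K] AdicCompletion hI A :=
  extend₂ ((LinearMap.mul K A).compr₂ (AdicCompletion.of hI A))

lemma cMul_of (x y : A) : cMul A (AdicCompletion.of hI A x) (AdicCompletion.of hI A y)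
    = AdicCompletion.of hI A (x * y) := by
  simp [cMul]

lemma one_cMul (z : AdicCompletion hI A) : cMul A (AdicCompletion.of hI A 1) z = z := by
  have : cMul A (AdicCompletion.of hI A 1) = LinearMap.id :=
    eq_of_eq_of fun x => by simp [cMul_of]
  rw [this]; rfl

lemma cMul_one (z : AdicCompletion hI A) : cMul A z (AdicCompletion.of hI A 1) = z := by
  have : (cMul A).flip (AdicCompletion.of hI A 1) = LinearMap.id :=
    eq_of_eq_of fun x => by simp [cMul_of]
  exact LinearMap.congr_fun this z

lemma cMul_assoc (x y z : AdicCompletion hI A) :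
    cMul A (cMul A x y) z = cMul A x (cMul A y z) := by
  have h1 : ∀ a b : A, cMul A (cMul A (AdicCompletion.of hI A a) (AdicCompletion.of hI A b))
      = cMul A (AdicCompletion.of hI A a) ∘ₗ cMul A (AdicCompletion.of hI A b) :=
    fun a b => eq_of_eq_of fun c => by simp [cMul_of, mul_assoc]
  have h2 := eq_of_eq_of₂ (f := (cMul A).compr₂ ((cMul A).flip z))
    (g := (cMul A).compl₂ ((cMul A).flip z)) (fun a b => by
      simpa using LinearMap.congr_fun (h1 a b) z) x y
  simpa using h2

/-- The ring structure on the completion of a (possibly noncommutative) algebra. -/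
noncomputable abbrev completionRing : Ring (AdicCompletion hI A) where
  __ := (inferInstance : AddCommGroup (AdicCompletion hI A))
  mul x y := cMul A x y
  one := AdicCompletion.of hI A 1
  left_distrib x y z := map_add (cMul A x) y z
  right_distrib x y z := LinearMap.map_add₂ (cMul A) x y z
  zero_mul x := LinearMap.map_zero₂ (cMul A) x
  mul_zero x := map_zero (cMul A x)
  mul_assoc := cMul_assoc A
  one_mul := one_cMul A
  mul_one := cMul_one A

/-- The algebra structure on the completion of a (possibly noncommutative) algebra. -/
noncomputable abbrev completionAlgebra :
    letI := completionRing A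
    Algebra K (AdicCompletion hI A) :=
  letI := completionRing A
  Algebra.ofModule (fun r x y => LinearMap.map_smul₂ (cMul A) r x y)
    (fun r x y => map_smul (cMul A x) r y)

end CompletedAlgebra

end BandMap

namespace BandMap

open scoped TensorProduct Nat

/-- The four generators of the algebra `𝔻`. -/
inductive Gen : Type
  | y | t | a | x

/-- The free algebra `ℚ[ε]⟨y, t, a, x⟩`. -/
abbrev Free : Type := FreeAlgebra Qe Gen

/-- The topologically free algebra `ℚ[ε]⟨y, t, a, x⟩[[h]]`. -/
abbrev FreeH : Type := PowerSeries Free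

/-- `ℚ[ε]⟨y, t, a, x⟩[[h]]` as an algebra over `ℚ[ε][[h]]`. -/
noncomputable instance algebraFreeH : Algebra K FreeH where
  algebraMap := PowerSeries.map (algebraMap Qe Free)
  smul r f := PowerSeries.map (algebraMap Qe Free) r * f
  smul_def' _ _ := rfl
  commutes' r f := by
    ext n
    rw [PowerSeries.coeff_mul, PowerSeries.coeff_mul, ← Finset.Nat.sum_antidiagonal_swap]
    refine Finset.sum_congr rfl fun p _ => ?_
    simp only [PowerSeries.coeff_map, Prod.fst_swap, Prod.snd_swap]
    exact Algebra.commutes _ _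

lemma algebraMap_freeH (r : K) :
    algebraMap K FreeH r = PowerSeries.map (algebraMap Qe Free) r := rfl

lemma h_pow_smul_freeH (n : ℕ) (f : FreeH) : h ^ n • f = PowerSeries.X ^ n * f := by
  rw [Algebra.smul_def, algebraMap_freeH, map_pow, PowerSeries.map_X]

/-- The generators, as elements of `ℚ[ε]⟨y, t, a, x⟩[[h]]`. -/
noncomputable def gen (g : Gen) : FreeH := PowerSeries.C (FreeAlgebra.ι Qe g)

/-- The scalar `q = e^{hε}`. -/
noncomputable def q : K := expSeries (Polynomial.X : Qe)

/-- The series `A = e^{-hεa}` in the free algebra. -/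
noncomputable def freeA : FreeH := expSeries (-((Polynomial.X : Qe) • FreeAlgebra.ι Qe Gen.a))

/-- The series `T = e^{-ht}` in the free algebra. -/
noncomputable def freeT : FreeH := expSeries (-FreeAlgebra.ι Qe Gen.t)

/-- The defining relations `[t, -] = 0`, `[a, x] = x`, `[a, y] = -y` and
`xy - q yx = (1 - A²T) / h`, as elements that have to vanish. -/
def relators : Set FreeH :=
  {r | ∃ g : Gen, r = gen Gen.t * gen g - gen g * gen Gen.t} ∪
  {gen Gen.a * gen Gen.x - gen Gen.x * gen Gen.a - gen Gen.x,
   gen Gen.a * gen Gen.y - gen Gen.y * gen Gen.a + gen Gen.y,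
   gen Gen.x * gen Gen.y - q • (gen Gen.y * gen Gen.x) - shift (1 - freeA ^ 2 * freeT)}

/-- The closure, in the `h`-adic topology, of the two-sided ideal generated by the relations. -/
noncomputable def closedIdeal : TwoSidedIdeal FreeH :=
  TwoSidedIdeal.mk'
    {f | ∀ n : ℕ, ∃ g ∈ TwoSidedIdeal.span relators, ∃ r : FreeH, f - g = h ^ n • r}
    (fun _ => ⟨0, TwoSidedIdeal.zero_mem _, 0, by simp⟩)
    (by
      intro f f' hf hf' n
      obtain ⟨g, hg, r, hr⟩ := hf n
      obtain ⟨g', hg', r', hr'⟩ := hf' n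
      exact ⟨g + g', TwoSidedIdeal.add_mem _ hg hg', r + r', by
        rw [smul_add, ← hr, ← hr']; abel⟩)
    (by
      intro f hf n
      obtain ⟨g, hg, r, hr⟩ := hf n
      exact ⟨-g, TwoSidedIdeal.neg_mem _ hg, -r, by rw [smul_neg, ← hr]; abel⟩)
    (by
      intro f f' hf n
      obtain ⟨g, hg, r, hr⟩ := hf n
      exact ⟨f * g, TwoSidedIdeal.mul_mem_left _ _ _ hg, f * r, by
        rw [← mul_smul_comm, ← hr, mul_sub]⟩)
    (by
      intro f f' hf n
      obtain ⟨g, hg, r, hr⟩ := hf n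
      exact ⟨g * f', TwoSidedIdeal.mul_mem_right _ _ _ hg, r * f', by
        rw [← smul_mul_assoc, ← hr, sub_mul]⟩)

lemma mem_closedIdeal (f : FreeH) : f ∈ closedIdeal ↔
    ∀ n : ℕ, ∃ g ∈ TwoSidedIdeal.span relators, ∃ r : FreeH, f - g = h ^ n • r :=
  TwoSidedIdeal.mem_mk' _ _ _ _ _ _ _

/-- The algebra `𝔻` over `ℚ[ε][[h]]` topologically generated by `y, t, a, x` subject to the
relations above. -/
def D : Type := closedIdeal.ringCon.Quotient

noncomputable instance : Ring D := inferInstanceAs (Ring closedIdeal.ringCon.Quotient)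

noncomputable instance : Algebra K D := inferInstanceAs (Algebra K closedIdeal.ringCon.Quotient)

noncomputable instance : Algebra ℚ D := Algebra.compHom D (algebraMap ℚ K)

/-- The quotient map onto `𝔻`. -/
noncomputable def toD : FreeH →ₐ[K] D := closedIdeal.ringCon.mkₐ (α := K)

lemma toD_surjective : Function.Surjective toD := Quotient.mk''_surjective

lemma toD_eq_zero (f : FreeH) : toD f = 0 ↔ f ∈ closedIdeal := by
  rw [TwoSidedIdeal.mem_iff, ← RingCon.eq]
  rfl

lemma exists_freeH_sum (c : ℕ → FreeH) : ∃ s : FreeH, ∀ n : ℕ, ∃ r : FreeH,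
    (∑ i ∈ Finset.range n, h ^ i • c i) - s = h ^ n • r := by
  refine ⟨PowerSeries.mk fun m => PowerSeries.coeff m
    (∑ i ∈ Finset.range (m + 1), h ^ i • c i), fun n => ?_⟩
  suffices PowerSeries.X ^ n ∣ ((∑ i ∈ Finset.range n, h ^ i • c i) - PowerSeries.mk fun m =>
      PowerSeries.coeff m (∑ i ∈ Finset.range (m + 1), h ^ i • c i)) by
    obtain ⟨r, hr⟩ := this
    exact ⟨r, by rw [hr, h_pow_smul_freeH]⟩
  rw [PowerSeries.X_pow_dvd_iff]
  intro m hm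
  obtain ⟨k, rfl⟩ := Nat.exists_eq_add_of_le (Nat.succ_le_of_lt hm)
  rw [map_sub, PowerSeries.coeff_mk, sub_eq_zero, Nat.succ_eq_add_one, Finset.sum_range_add,
    map_add, add_eq_left, map_sum]
  refine Finset.sum_eq_zero fun i _ => ?_
  rw [h_pow_smul_freeH, PowerSeries.coeff_X_pow_mul', if_neg (by omega)]

instance : IsAdicComplete hI D := by
  apply isAdicComplete_of
  · intro x hx
    obtain ⟨f, rfl⟩ := toD_surjective x
    rw [toD_eq_zero, mem_closedIdeal]
    intro n
    obtain ⟨r, hr⟩ := hx n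
    obtain ⟨r, rfl⟩ := toD_surjective r
    have : f - h ^ n • r ∈ closedIdeal := by
      rw [← toD_eq_zero, map_sub, map_smul, hr, sub_self]
    obtain ⟨g, hg, s, hs⟩ := (mem_closedIdeal _).1 this n
    exact ⟨g, hg, s + r, by rw [smul_add, ← hs]; abel⟩
  · intro c
    choose d hd using fun i => toD_surjective (c i)
    obtain ⟨s, hs⟩ := exists_freeH_sum d
    refine ⟨toD s, fun n => ?_⟩
    obtain ⟨r, hr⟩ := hs n
    refine ⟨toD r, ?_⟩
    rw [← map_smul, ← hr, map_sub, map_sum]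
    simp [hd]

section Lift

variable {C : Type*} [Ring C] [Algebra K C]

/-- Evaluation of noncommutative polynomials at a family of elements of a `ℚ[ε][[h]]`-algebra. -/
noncomputable def evalFree (v : Gen → C) : Free →+* C :=
  letI := Algebra.compHom C (PowerSeries.C : Qe →+* K)
  (FreeAlgebra.lift Qe v : Free →ₐ[Qe] C).toRingHom

lemma evalFree_ι (v : Gen → C) (g : Gen) : evalFree v (FreeAlgebra.ι Qe g) = v g :=
  letI := Algebra.compHom C (PowerSeries.C : Qe →+* K)
  FreeAlgebra.lift_ι_apply (R := Qe) v g

lemma evalFree_algebraMap (v : Gen → C) (r : Qe) :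
    evalFree v (algebraMap Qe Free r) = algebraMap K C (PowerSeries.C r) :=
  letI := Algebra.compHom C (PowerSeries.C : Qe →+* K)
  (FreeAlgebra.lift Qe v : Free →ₐ[Qe] C).commutes r

lemma hSum_scalar (r : K) : hSum (PowerSeries.map (PowerSeries.C : Qe →+* K) r) = r := by
  apply hSum_unique
  intro n
  suffices PowerSeries.X ^ n ∣ ((∑ i ∈ Finset.range n, h ^ i •
      PowerSeries.coeff i (PowerSeries.map (PowerSeries.C : Qe →+* K) r)) - r) from this
  rw [PowerSeries.X_pow_dvd_iff]
  intro m hm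
  rw [map_sub, map_sum, sub_eq_zero, Finset.sum_eq_single m]
  · simp
  · intro b _ hb
    simp only [PowerSeries.coeff_map, smul_eq_mul, PowerSeries.coeff_X_pow_mul',
      PowerSeries.coeff_C]
    split_ifs <;> first | rfl | omega
  · intro H
    exact absurd (Finset.mem_range.2 hm) H

lemma map_expSeries {R S : Type*} [Ring R] [Algebra ℚ R] [Ring S] [Algebra ℚ S] (ψ : R →+* S)
    (u : R) : PowerSeries.map ψ (expSeries u) = expSeries (ψ u) := by
  ext n
  simp only [expSeries, PowerSeries.coeff_map, PowerSeries.coeff_mk, map_rat_smul, map_pow]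

lemma map_shift {R S : Type*} [Ring R] [Ring S] (ψ : R →+* S) (f : PowerSeries R) :
    PowerSeries.map ψ (shift f) = shift (PowerSeries.map ψ f) := by
  ext n
  simp [shift]

/-- The exponent `-(2εa + t)`, for which `e^{h(-(2εa + t))} = A²T`. -/
noncomputable def wexp (t a : C) : C := -(eps • (a + a) + t)

lemma expSeries_wexp [Algebra ℚ C] {t a : C} (hta : Commute t a) :
    expSeries (-(eps • a)) ^ 2 * expSeries (-t) = expSeries (wexp t a) := by
  have h1 : Commute (-(eps • a)) (-(eps • a)) := Commute.refl _
  have h2 : Commute (-(eps • a) + -(eps • a)) (-t) := by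
    have := (hta.symm.smul_left eps).neg_left.neg_right
    exact this.add_left this
  rw [pow_two, ← expSeries_add h1, ← expSeries_add h2]
  congr 1
  rw [wexp, smul_add]
  abel

variable [IsAdicComplete hI C]

/-- Evaluation of elements of `ℚ[ε]⟨y, t, a, x⟩[[h]]` in a complete algebra. -/
noncomputable def evalFreeH (v : Gen → C) : FreeH →ₐ[K] C where
  __ := hEval.comp (PowerSeries.map (evalFree v))
  commutes' r := by
    change hSum (PowerSeries.map (evalFree v) (PowerSeries.map (algebraMap Qe Free) r)) = _
    rw [hSum_map (Algebra.linearMap K C) (PowerSeries.map (PowerSeries.C : Qe →+* K) r) _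
      (fun n => by
        simp only [PowerSeries.coeff_map, evalFree_algebraMap]; rfl), hSum_scalar]
    rfl

lemma evalFreeH_apply (v : Gen → C) (f : FreeH) :
    evalFreeH v f = hEval (PowerSeries.map (evalFree v) f) := rfl

lemma evalFreeH_gen (v : Gen → C) (g : Gen) : evalFreeH v (gen g) = v g := by
  rw [evalFreeH_apply, gen, PowerSeries.map_C, hEval_apply, hSum_C, evalFree_ι]

variable [Algebra ℚ C]

lemma evalFreeH_rel (v : Gen → C) (hta : Commute (v Gen.t) (v Gen.a)) :
    evalFreeH v (shift (1 - freeA ^ 2 * freeT)) = hQuot (wexp (v Gen.t) (v Gen.a)) := by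
  rw [evalFreeH_apply, map_shift, map_sub, map_one, map_mul, map_pow, freeA, freeT,
    map_expSeries, map_expSeries, map_neg, map_neg, evalFree_ι, Algebra.smul_def, map_mul,
    evalFree_ι, evalFree_algebraMap, ← Algebra.smul_def, expSeries_wexp hta]
  rfl

/-- A family of elements of a complete algebra that satisfies the defining relations of `𝔻`. -/
structure Rels (v : Gen → C) : Prop where
  t_comm : ∀ g, Commute (v Gen.t) (v g)
  a_x : v Gen.a * v Gen.x = v Gen.x * v Gen.a + v Gen.x
  a_y : v Gen.a * v Gen.y = v Gen.y * v Gen.a - v Gen.y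
  x_y : v Gen.x * v Gen.y = q • (v Gen.y * v Gen.x) + hQuot (wexp (v Gen.t) (v Gen.a))

lemma Rels.closedIdeal {v : Gen → C} (hv : Rels v) {f : FreeH} (hf : f ∈ closedIdeal) :
    evalFreeH v f = 0 := by
  have h1 : TwoSidedIdeal.span relators ≤ TwoSidedIdeal.ker (evalFreeH v) := by
    rw [TwoSidedIdeal.span_le]
    rintro r (⟨g, rfl⟩ | rfl | rfl | rfl)
    all_goals rw [SetLike.mem_coe, TwoSidedIdeal.mem_ker]
    · simp only [map_sub, map_mul, evalFreeH_gen, (hv.t_comm g).eq, sub_self]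
    · simp only [map_sub, map_mul, evalFreeH_gen, hv.a_x]
      abel
    · simp only [map_sub, map_add, map_mul, evalFreeH_gen, hv.a_y]
      abel
    · rw [map_sub, map_sub, map_smul, map_mul, map_mul, evalFreeH_rel v (hv.t_comm _)]
      simp only [evalFreeH_gen, hv.x_y]
      abel
  apply eq_of_forall_h
  intro n
  obtain ⟨g, hg, r, hr⟩ := (mem_closedIdeal f).1 hf n
  refine ⟨evalFreeH v r, ?_⟩
  have hg0 : evalFreeH v g = 0 := (TwoSidedIdeal.mem_ker _).1 (h1 hg)
  rw [← map_smul, ← hr, map_sub, hg0]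

/-- The algebra homomorphism from `𝔻` given by a family that satisfies the relations. -/
noncomputable def liftD (v : Gen → C) (hv : Rels v) : D →ₐ[K] C :=
  RingCon.liftₐ closedIdeal.ringCon (evalFreeH v) (by
    intro f g hfg
    have := hv.closedIdeal ((TwoSidedIdeal.rel_iff _ _ _).1 hfg)
    rw [map_sub, sub_eq_zero] at this
    exact this)

lemma liftD_toD (v : Gen → C) (hv : Rels v) (f : FreeH) : liftD v hv (toD f) = evalFreeH v f := rfl

end Lift
end BandMap

namespace BandMap

open scoped TensorProduct Nat

section Generators

/-- The generators of `𝔻`. -/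
noncomputable def gD (g : Gen) : D := toD (gen g)

/-- `A = e^{-hεa}` in `𝔻`. -/
noncomputable def AD : D := hExp (-(eps • gD Gen.a))

/-- `A⁻¹ = e^{hεa}` in `𝔻`. -/
noncomputable def AinvD : D := hExp (eps • gD Gen.a)

/-- `T = e^{-ht}` in `𝔻`. -/
noncomputable def TD : D := hExp (-gD Gen.t)

/-- `T⁻¹ = e^{ht}` in `𝔻`. -/
noncomputable def TinvD : D := hExp (gD Gen.t)

lemma toD_C (u : Free) : toD (PowerSeries.C u) = evalFree gD u := by
  induction u using FreeAlgebra.induction with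
  | grade0 r =>
    rw [evalFree_algebraMap, ← toD.commutes, algebraMap_freeH, PowerSeries.map_C]
  | grade1 g => rw [evalFree_ι]; rfl
  | mul a b ha hb => rw [map_mul, map_mul, map_mul, ha, hb]
  | add a b ha hb => rw [map_add, map_add, map_add, ha, hb]

lemma evalFreeH_gD (f : FreeH) : evalFreeH gD f = toD f := by
  apply hSum_unique
  intro n
  have : PowerSeries.X ^ n ∣
      (∑ i ∈ Finset.range n, h ^ i • PowerSeries.C (PowerSeries.coeff i f)) - f := by
    rw [PowerSeries.X_pow_dvd_iff]
    intro m hm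
    rw [map_sub, map_sum, sub_eq_zero, Finset.sum_eq_single m]
    · simp [h_pow_smul_freeH]
    · intro b _ hb
      simp only [h_pow_smul_freeH, PowerSeries.coeff_X_pow_mul', PowerSeries.coeff_C]
      split_ifs <;> first | rfl | omega
    · intro H
      exact absurd (Finset.mem_range.2 hm) H
  obtain ⟨r, hr⟩ := this
  refine ⟨toD r, ?_⟩
  rw [← map_smul, h_pow_smul_freeH, ← hr, map_sub, map_sum]
  simp [toD_C]

lemma relsD : Rels gD := by
  have key : ∀ f ∈ relators, evalFreeH gD f = 0 := by
    intro f hf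
    rw [evalFreeH_gD, toD_eq_zero, mem_closedIdeal]
    exact fun n => ⟨f, TwoSidedIdeal.subset_span hf, 0, by simp⟩
  have ht : ∀ g, Commute (gD Gen.t) (gD g) := fun g => by
    have := key _ (Or.inl ⟨g, rfl⟩)
    simp only [map_sub, map_mul, evalFreeH_gen, sub_eq_zero] at this
    exact this
  refine ⟨ht, ?_, ?_, ?_⟩
  · have := key _ (Or.inr (Or.inl rfl))
    simp only [map_sub, map_mul, evalFreeH_gen] at this
    rw [← sub_eq_zero, ← this]
    abel
  · have := key _ (Or.inr (Or.inr (Or.inl rfl)))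
    simp only [map_sub, map_add, map_mul, evalFreeH_gen] at this
    rw [← sub_eq_zero, ← this]
    abel
  · have := key _ (Or.inr (Or.inr (Or.inr rfl)))
    rw [map_sub, map_sub, map_smul, map_mul, map_mul, evalFreeH_rel gD (ht _)] at this
    simp only [evalFreeH_gen] at this
    rw [← sub_eq_zero, ← this]
    abel

end Generators

section Commutation

variable {C : Type*} [Ring C] [Algebra K C] [Algebra ℚ C] [IsAdicComplete hI C]

lemma hExp_eps : hExp (eps • (1 : C)) = q • (1 : C) := by
  have h1 : hExp (eps : K) = q := by
    have : expSeries (eps : K) = PowerSeries.map (PowerSeries.C : Qe →+* K) q := by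
      rw [q, map_expSeries]
    rw [hExp, hEval_apply, this, hSum_scalar]
  rw [hExp_map (Algebra.linearMap K C) (eps : K) (eps • (1 : C)) (fun n => by
    simp [Algebra.smul_def]), h1, Algebra.smul_def, mul_one]
  rfl

lemma hExp_add_eps (u : C) : hExp (u + eps • (1 : C)) = q • hExp u := by
  rw [hExp_add ((Commute.one_right u).smul_right eps), hExp_eps, mul_smul_comm, mul_one]

lemma hExp_comm {u w : C} (H : Commute u w) : Commute u (hExp w) := mul_hExp H

variable {v : Gen → C}

lemma Rels.x_A (hv : Rels v) :
    v Gen.x * hExp (-(eps • v Gen.a)) = q • (hExp (-(eps • v Gen.a)) * v Gen.x) := by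
  rw [← smul_mul_assoc, ← hExp_add_eps]
  apply mul_hExp
  rw [add_mul, neg_mul, mul_neg, mul_smul_comm, smul_mul_assoc, smul_mul_assoc, hv.a_x, one_mul,
    smul_add]
  abel

lemma Rels.x_Ainv (hv : Rels v) :
    hExp (eps • v Gen.a) * v Gen.x = q • (v Gen.x * hExp (eps • v Gen.a)) := by
  rw [← mul_smul_comm, ← hExp_add_eps]
  symm
  apply mul_hExp
  rw [mul_add, mul_smul_comm, mul_smul_comm, smul_mul_assoc, hv.a_x, mul_one, smul_add]

lemma Rels.y_A (hv : Rels v) :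
    hExp (-(eps • v Gen.a)) * v Gen.y = q • (v Gen.y * hExp (-(eps • v Gen.a))) := by
  rw [← mul_smul_comm, ← hExp_add_eps]
  symm
  apply mul_hExp
  rw [mul_add, neg_mul, mul_neg, mul_smul_comm, mul_smul_comm, smul_mul_assoc, hv.a_y, mul_one,
    smul_sub]
  abel

lemma Rels.y_Ainv (hv : Rels v) :
    v Gen.y * hExp (eps • v Gen.a) = q • (hExp (eps • v Gen.a) * v Gen.y) := by
  rw [← smul_mul_assoc, ← hExp_add_eps]
  apply mul_hExp
  rw [add_mul, smul_mul_assoc, hv.a_y, smul_mul_assoc, one_mul, mul_smul_comm, smul_sub]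
  abel

lemma Rels.comm_T (hv : Rels v) (g : Gen) : Commute (v g) (hExp (-v Gen.t)) :=
  hExp_comm (hv.t_comm g).symm.neg_right

lemma Rels.comm_Tinv (hv : Rels v) (g : Gen) : Commute (v g) (hExp (v Gen.t)) :=
  hExp_comm (hv.t_comm g).symm

lemma a_comm_A (a : C) : Commute a (hExp (-(eps • a))) :=
  hExp_comm ((Commute.refl a).smul_right eps).neg_right

lemma a_comm_Ainv (a : C) : Commute a (hExp (eps • a)) :=
  hExp_comm ((Commute.refl a).smul_right eps)

lemma hExp_wexp {t a : C} (hta : Commute t a) :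
    hExp (-(eps • a)) * (hExp (-t) * hExp (-(eps • a))) = hExp (wexp t a) := by
  have h1 : Commute (-t) (-(eps • a)) := (hta.smul_right eps).neg_left.neg_right
  have h2 : Commute (-(eps • a)) (-t + -(eps • a)) := h1.symm.add_right (Commute.refl _)
  rw [← hExp_add h1, ← hExp_add h2]
  congr 1
  rw [wexp, smul_add]
  abel

lemma hExp_neg_wexp {t a : C} (hta : Commute t a) :
    hExp (eps • a) * (hExp (eps • a) * hExp t) = hExp (-wexp t a) := by
  have h1 : Commute (eps • a) t := (hta.smul_right eps).symm
  have h2 : Commute (eps • a) (eps • a + t) := (Commute.refl _).add_right h1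
  rw [← hExp_add h1, ← hExp_add h2]
  congr 1
  rw [wexp, smul_add]
  abel

lemma hQuot_neg (u : C) : hQuot (-u) = -(hQuot u * hExp (-u)) := by
  have h1 := hQuot_add (Commute.neg_right (Commute.refl u))
  have h2 : hQuot (0 : C) = 0 := by
    have : shift (1 - expSeries (0 : C)) = 0 := by
      rw [expSeries_zero, sub_self]; ext n; simp [shift]
    rw [hQuot, this, map_zero]
  rw [add_neg_cancel, h2] at h1
  exact eq_neg_of_add_eq_zero_left h1.symm

lemma Rels.map {C' : Type*} [Ring C'] [Algebra K C'] [Algebra ℚ C'] [IsAdicComplete hI C']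
    {v : Gen → C} (hv : Rels v) (f : C →ₐ[K] C') : Rels fun g => f (v g) where
  t_comm g := (hv.t_comm g).map f
  a_x := by rw [← map_mul, hv.a_x, map_add, map_mul]
  a_y := by rw [← map_mul, hv.a_y, map_sub, map_mul]
  x_y := by
    rw [← map_mul, hv.x_y, map_add, map_smul, map_mul,
      hQuot_map f.toLinearMap (wexp (v Gen.t) (v Gen.a)) (wexp (f (v Gen.t)) (f (v Gen.a)))]
    · rfl
    · intro n
      simp [wexp]

end Commutation

section Comultiplication

/-- The completed tensor product `𝔻 ⊗̂ 𝔻`. -/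
def DD : Type := AdicCompletion hI (D ⊗[K] D)

/-- The ring structure of `𝔻 ⊗̂ 𝔻`. -/
noncomputable def ringDD : Ring DD := completionRing (D ⊗[K] D)

noncomputable instance : Ring DD := ringDD

/-- The algebra structure of `𝔻 ⊗̂ 𝔻`. -/
noncomputable def algebraDD : Algebra K DD := completionAlgebra (D ⊗[K] D)

noncomputable instance : Algebra K DD := algebraDD

noncomputable instance : Algebra ℚ DD := Algebra.compHom DD (algebraMap ℚ K)

instance : IsAdicComplete hI DD :=
  inferInstanceAs (IsAdicComplete hI (AdicCompletion hI (D ⊗[K] D)))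

/-- The canonical map from the algebraic to the completed tensor product. -/
noncomputable def toDD : D ⊗[K] D →ₐ[K] DD :=
  AlgHom.ofLinearMap (AdicCompletion.of hI (D ⊗[K] D)) rfl fun x y => (cMul_of _ x y).symm

/-- The map `u ↦ u ⊗ 1`. -/
noncomputable def inl : D →ₐ[K] DD := toDD.comp Algebra.TensorProduct.includeLeft

/-- The map `u ↦ 1 ⊗ u`. -/
noncomputable def inr : D →ₐ[K] DD := toDD.comp Algebra.TensorProduct.includeRight

lemma inl_comm_inr (u w : D) : Commute (inl u) (inr w) := by
  have : Commute (u ⊗ₜ[K] (1 : D)) ((1 : D) ⊗ₜ[K] w) := by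
    simp [Commute, SemiconjBy, Algebra.TensorProduct.tmul_mul_tmul]
  exact this.map toDD

/-- The values of the comultiplication on the generators:
`Δ(y) = 1 ⊗ y + y ⊗ TA`, `Δ(t) = t ⊗ 1 + 1 ⊗ t`, `Δ(a) = a ⊗ 1 + 1 ⊗ a`, `Δ(x) = 1 ⊗ x + x ⊗ A`. -/
noncomputable def comulGen : Gen → DD
  | Gen.y => toDD ((1 : D) ⊗ₜ[K] gD Gen.y + gD Gen.y ⊗ₜ[K] (TD * AD))
  | Gen.t => toDD (gD Gen.t ⊗ₜ[K] (1 : D) + (1 : D) ⊗ₜ[K] gD Gen.t)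
  | Gen.a => toDD (gD Gen.a ⊗ₜ[K] (1 : D) + (1 : D) ⊗ₜ[K] gD Gen.a)
  | Gen.x => toDD ((1 : D) ⊗ₜ[K] gD Gen.x + gD Gen.x ⊗ₜ[K] AD)

lemma toDD_tmul (u w : D) : toDD (u ⊗ₜ[K] w) = inl u * inr w := by
  rw [inl, inr, AlgHom.comp_apply, AlgHom.comp_apply, ← map_mul]
  simp [Algebra.TensorProduct.tmul_mul_tmul]

lemma comul_xy_aux {R : Type*} [Ring R] [Algebra K R] {x₁ y₁ x₂ y₂ A B P₁ P₂ : R}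
    (h₁ : x₁ * y₁ = q • (y₁ * x₁) + P₁) (h₂ : x₂ * y₂ = q • (y₂ * x₂) + P₂)
    (c₁ : Commute y₁ x₂) (c₂ : Commute x₁ y₂) (c₄ : Commute y₁ A)
    (c₅ : Commute x₁ B) (hA : A * y₂ = q • (y₂ * A)) (hB : x₂ * B = q • (B * x₂))
    (hAB : Commute A B) :
    (x₂ + x₁ * A) * (y₂ + y₁ * B)
      = q • ((y₂ + y₁ * B) * (x₂ + x₁ * A)) + (P₂ + P₁ * (A * B)) := by
  have e₁ : x₂ * (y₁ * B) = q • (y₁ * B * x₂) := by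
    rw [← mul_assoc, ← c₁.eq, mul_assoc, hB, mul_smul_comm, mul_assoc]
  have e₂ : x₁ * A * y₂ = q • (y₂ * (x₁ * A)) := by
    rw [mul_assoc, hA, mul_smul_comm, ← mul_assoc, c₂.eq, mul_assoc]
  have e₃ : x₁ * A * (y₁ * B) = q • (y₁ * B * (x₁ * A)) + P₁ * (A * B) := by
    rw [mul_assoc, ← mul_assoc A, ← c₄.eq, mul_assoc y₁, ← mul_assoc, h₁, add_mul, smul_mul_assoc,
      mul_assoc y₁ B, ← mul_assoc B, ← c₅.eq, mul_assoc, hAB.eq, mul_assoc]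
  rw [add_mul, mul_add, mul_add, h₂, e₁, e₂, e₃, add_mul, mul_add, mul_add]
  simp only [smul_add]
  abel

lemma comulGen_rels : Rels comulGen := by
  have r₁ := relsD.map inl
  have r₂ := relsD.map inr
  have hA : inr AD = hExp (-(eps • inr (gD Gen.a))) :=
    (hExp_map inr.toLinearMap (-(eps • gD Gen.a)) _ fun n => by simp).symm
  have hT : inr TD = hExp (-inr (gD Gen.t)) :=
    (hExp_map inr.toLinearMap (-gD Gen.t) _ fun n => by simp).symm
  have ey : comulGen Gen.y = inr (gD Gen.y) + inl (gD Gen.y) * (inr TD * inr AD) := by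
    rw [comulGen, map_add, toDD_tmul, toDD_tmul, map_one, one_mul, map_mul]
  have et : comulGen Gen.t = inl (gD Gen.t) + inr (gD Gen.t) := by
    rw [comulGen, map_add, toDD_tmul, toDD_tmul, map_one inl, one_mul, map_one, mul_one]
  have ea : comulGen Gen.a = inl (gD Gen.a) + inr (gD Gen.a) := by
    rw [comulGen, map_add, toDD_tmul, toDD_tmul, map_one inl, one_mul, map_one, mul_one]
  have ex : comulGen Gen.x = inr (gD Gen.x) + inl (gD Gen.x) * inr AD := by
    rw [comulGen, map_add, toDD_tmul, toDD_tmul, map_one, one_mul]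
  have tA : Commute (inr (gD Gen.t)) (inr AD) := by
    rw [hA]
    exact hExp_comm ((r₂.t_comm Gen.a).smul_right eps).neg_right
  have tT : Commute (inr (gD Gen.t)) (inr TD) := by
    rw [hT]
    exact r₂.comm_T Gen.t
  have aA : Commute (inr (gD Gen.a)) (inr AD) := by
    rw [hA]
    exact a_comm_A _
  have aT : Commute (inr (gD Gen.a)) (inr TD) := by
    rw [hT]
    exact r₂.comm_T Gen.a
  have TA : Commute (inr TD) (inr AD) := by
    rw [hA]
    exact hExp_comm ((aT.symm.smul_right eps).neg_right)
  have tg : ∀ g, Commute (inl (gD Gen.t)) (inr g) := fun g => inl_comm_inr _ _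
  refine ⟨fun g => ?_, ?_, ?_, ?_⟩
  · rw [et]
    cases g
    · rw [ey]
      refine Commute.add_left (Commute.add_right (tg _) ?_) (Commute.add_right (r₂.t_comm _) ?_)
      · exact (r₁.t_comm Gen.y).mul_right ((tg _).mul_right (tg _))
      · exact (inl_comm_inr _ _).symm.mul_right (tT.mul_right tA)
    · rw [et]
    · rw [ea]
      exact Commute.add_left (Commute.add_right (r₁.t_comm Gen.a) (tg _))
        (Commute.add_right (inl_comm_inr _ _).symm (r₂.t_comm Gen.a))
    · rw [ex]
      exact Commute.add_left (Commute.add_right (tg _) ((r₁.t_comm Gen.x).mul_right (tg _)))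
        (Commute.add_right (r₂.t_comm Gen.x) ((inl_comm_inr _ _).symm.mul_right tA))
  · rw [ea, ex, add_mul, mul_add, mul_add, add_mul, mul_add, mul_add,
      (inl_comm_inr (gD Gen.a) (gD Gen.x)).eq, r₂.a_x, ← mul_assoc, r₁.a_x, ← mul_assoc,
      ← (inl_comm_inr (gD Gen.x) (gD Gen.a)).eq, add_mul]
    simp only [mul_assoc]
    rw [aA.eq, (inl_comm_inr (gD Gen.a) AD).eq]
    abel
  · have aB : Commute (inr (gD Gen.a)) (inr TD * inr AD) := aT.mul_right aA
    have aB' : Commute (inl (gD Gen.a)) (inr TD * inr AD) :=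
      (inl_comm_inr _ _).mul_right (inl_comm_inr _ _)
    rw [ea, ey]
    generalize inr TD * inr AD = B at aB aB'
    rw [add_mul, mul_add, mul_add, add_mul, mul_add, mul_add,
      (inl_comm_inr (gD Gen.a) (gD Gen.y)).eq, r₂.a_y, ← mul_assoc, r₁.a_y, ← mul_assoc,
      ← (inl_comm_inr (gD Gen.y) (gD Gen.a)).eq, sub_mul]
    simp only [mul_assoc]
    rw [aB.eq, aB'.eq]
    abel
  · have hw : wexp (comulGen Gen.t) (comulGen Gen.a)
        = wexp (inl (gD Gen.t)) (inl (gD Gen.a)) + wexp (inr (gD Gen.t)) (inr (gD Gen.a)) := by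
      rw [et, ea]
      simp only [wexp, smul_add]
      abel
    have cw : Commute (wexp (inl (gD Gen.t)) (inl (gD Gen.a)))
        (wexp (inr (gD Gen.t)) (inr (gD Gen.a))) := by
      have : ∀ u w : D, wexp (inl u) (inl w) = inl (wexp u w) := fun u w => by simp [wexp]
      have h' : ∀ u w : D, wexp (inr u) (inr w) = inr (wexp u w) := fun u w => by simp [wexp]
      rw [this, h']
      exact inl_comm_inr _ _
    have hE := hExp_wexp (r₂.t_comm Gen.a)
    rw [← hA, ← hT] at hE
    rw [hw, hQuot_add cw, ← hE, ex, ey]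
    refine comul_xy_aux r₁.x_y r₂.x_y (inl_comm_inr _ _) (inl_comm_inr _ _)
      (inl_comm_inr _ _) ((inl_comm_inr _ _).mul_right (inl_comm_inr _ _)) ?_ ?_
      (TA.symm.mul_right (Commute.refl _))
    · rw [hA]
      exact r₂.y_A
    · rw [hT, ← mul_assoc, (r₂.comm_T Gen.x).eq, mul_assoc, ← hT, hA, r₂.x_A, mul_smul_comm,
        mul_assoc]

/-- The comultiplication `Δ : 𝔻 → 𝔻 ⊗̂ 𝔻`. -/
noncomputable def comul : D →ₐ[K] DD := liftD comulGen comulGen_rels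

lemma comul_gD (g : Gen) : comul (gD g) = comulGen g := by
  rw [comul, gD, liftD_toD, evalFreeH_gen]

end Comultiplication

section Antipode

instance : IsAdicComplete hI Dᵐᵒᵖ := isAdicComplete_congr (MulOpposite.opLinearEquiv K)

/-- The values of the antipode on the generators:
`S(y) = -y(TA)⁻¹`, `S(t) = -t`, `S(a) = -a`, `S(x) = -xA⁻¹`. -/
noncomputable def antipodeGen : Gen → D
  | Gen.y => -(gD Gen.y * (AinvD * TinvD))
  | Gen.t => -gD Gen.t
  | Gen.a => -gD Gen.a
  | Gen.x => -(gD Gen.x * AinvD)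

lemma antipodeGen_rels : Rels fun g => MulOpposite.op (antipodeGen g) := by
  have aA : Commute (gD Gen.a) AinvD := a_comm_Ainv _
  have aT : Commute (gD Gen.a) TinvD := relsD.comm_Tinv Gen.a
  have AT : Commute AinvD TinvD := (hExp_comm ((aT.symm.smul_right eps))).symm
  have tA : Commute (gD Gen.t) AinvD := hExp_comm ((relsD.t_comm Gen.a).smul_right eps)
  have tT : Commute (gD Gen.t) TinvD := relsD.comm_Tinv Gen.t
  refine ⟨fun g => ?_, ?_, ?_, ?_⟩
  · refine Commute.op ?_
    cases g
    · exact ((relsD.t_comm Gen.y).mul_right (tA.mul_right tT)).neg_right.neg_left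
    · exact Commute.refl _
    · exact (relsD.t_comm Gen.a).neg_right.neg_left
    · exact ((relsD.t_comm Gen.x).mul_right tA).neg_right.neg_left
  · rw [← MulOpposite.op_mul, ← MulOpposite.op_mul, ← MulOpposite.op_add]
    congr 1
    simp only [antipodeGen, neg_mul_neg]
    rw [← mul_assoc, relsD.a_x, mul_assoc, ← aA.eq, add_mul, ← mul_assoc]
    abel
  · rw [← MulOpposite.op_mul, ← MulOpposite.op_mul, ← MulOpposite.op_sub]
    congr 1
    simp only [antipodeGen, neg_mul_neg]
    rw [← mul_assoc (gD Gen.a), relsD.a_y, mul_assoc (gD Gen.y) (AinvD * TinvD),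
      ← (aA.mul_right aT).eq, sub_mul, ← mul_assoc (gD Gen.y) (gD Gen.a)]
    abel
  · have hw : wexp (MulOpposite.op (antipodeGen Gen.t)) (MulOpposite.op (antipodeGen Gen.a))
        = MulOpposite.op (-wexp (gD Gen.t) (gD Gen.a)) := by
      simp only [antipodeGen, wexp, ← MulOpposite.op_add, ← MulOpposite.op_smul,
        ← MulOpposite.op_neg]
      congr 1
      simp only [smul_add, smul_neg]
      abel
    rw [hw, hQuot_map (MulOpposite.opLinearEquiv K : D ≃ₗ[K] Dᵐᵒᵖ).toLinearMap
      (-wexp (gD Gen.t) (gD Gen.a)) _ (fun n => by simp)]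
    simp only [LinearEquiv.coe_coe, MulOpposite.coe_opLinearEquiv]
    rw [← MulOpposite.op_mul, ← MulOpposite.op_mul, ← MulOpposite.op_smul, ← MulOpposite.op_add]
    congr 1
    simp only [antipodeGen, neg_mul_neg]
    have e₁ : AinvD * gD Gen.x = q • (gD Gen.x * AinvD) := relsD.x_Ainv
    have e₂ : gD Gen.y * AinvD = q • (AinvD * gD Gen.y) := relsD.y_Ainv
    have hE : AinvD * (AinvD * TinvD) = hExp (-wexp (gD Gen.t) (gD Gen.a)) :=
      hExp_neg_wexp (relsD.t_comm Gen.a)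
    have e₃ : gD Gen.y * (AinvD * TinvD) * (gD Gen.x * AinvD)
        = q • (gD Gen.y * gD Gen.x * (AinvD * (AinvD * TinvD))) := by
      have xT : Commute (gD Gen.x) TinvD := relsD.comm_Tinv Gen.x
      calc gD Gen.y * (AinvD * TinvD) * (gD Gen.x * AinvD)
          = gD Gen.y * (AinvD * (TinvD * gD Gen.x) * AinvD) := by simp only [mul_assoc]
        _ = gD Gen.y * ((AinvD * gD Gen.x) * (TinvD * AinvD)) := by
          rw [← xT.eq]; simp only [mul_assoc]
        _ = _ := by
          rw [e₁, ← AT.eq, smul_mul_assoc, mul_smul_comm]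
          simp only [mul_assoc]
    have e₄ : q • (gD Gen.x * AinvD * (gD Gen.y * (AinvD * TinvD)))
        = gD Gen.x * gD Gen.y * (AinvD * (AinvD * TinvD)) := by
      calc q • (gD Gen.x * AinvD * (gD Gen.y * (AinvD * TinvD)))
          = gD Gen.x * (q • (AinvD * gD Gen.y)) * (AinvD * TinvD) := by
            simp only [mul_smul_comm, smul_mul_assoc, mul_assoc]
        _ = _ := by
          rw [← e₂]
          simp only [mul_assoc]
    rw [e₃, e₄, relsD.x_y, hQuot_neg, ← hE, add_mul, smul_mul_assoc]
    abel

/-- The antipode as an algebra homomorphism to the opposite algebra. -/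
noncomputable def antipodeOp : D →ₐ[K] Dᵐᵒᵖ :=
  liftD (fun g => MulOpposite.op (antipodeGen g)) antipodeGen_rels

/-- The antipode `S : 𝔻 → 𝔻`, an algebra antihomomorphism. -/
noncomputable def antipode : D →ₗ[K] D :=
  (MulOpposite.opLinearEquiv K : D ≃ₗ[K] Dᵐᵒᵖ).symm.toLinearMap ∘ₗ antipodeOp.toLinearMap

lemma antipode_gD (g : Gen) : antipode (gD g) = antipodeGen g := by
  change MulOpposite.unop (antipodeOp (gD g)) = _
  rw [antipodeOp, gD, liftD_toD, evalFreeH_gen, MulOpposite.unop_op]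

lemma antipode_mul (u w : D) : antipode (u * w) = antipode w * antipode u := by
  change MulOpposite.unop (antipodeOp (u * w)) = _
  rw [map_mul, MulOpposite.unop_mul]
  rfl

end Antipode
end BandMap

namespace BandMap

open scoped TensorProduct Nat

section RMatrix

/-- The balancing element `κ = +√(A²T)`, that is `e^{-h(εa + t/2)}`. -/
noncomputable def kappa : D := hExp (-(eps • gD Gen.a) - (1 / 2 : ℚ) • gD Gen.t)

lemma kappa_mul_kappa : kappa * kappa = AD ^ 2 * TD := by
  have ha : Commute (-(eps • gD Gen.a)) (-(eps • gD Gen.a)) := Commute.refl _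
  have hat : Commute (-(eps • gD Gen.a) + -(eps • gD Gen.a)) (-gD Gen.t) := by
    have := ((relsD.t_comm Gen.a).symm.smul_left eps).neg_left.neg_right
    exact this.add_left this
  rw [kappa, ← hExp_add (Commute.refl _), AD, pow_two, TD, ← hExp_add ha, ← hExp_add hat]
  congr 1
  have : gD Gen.t = (1 / 2 : ℚ) • gD Gen.t + (1 / 2 : ℚ) • gD Gen.t := by
    rw [← add_smul]
    norm_num
  conv_rhs => rw [this]
  abel

/-- The quantum integer `[n]_q = (1 - qⁿ) / (1 - q) = 1 + q + ⋯ + qⁿ⁻¹`. -/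
noncomputable def qInt (n : ℕ) : K := ∑ i ∈ Finset.range n, q ^ i

lemma qInt_mul (n : ℕ) : qInt n * (1 - q) = 1 - q ^ n := by
  rw [qInt]
  exact geom_sum_mul_neg q n

/-- The quantum factorial `[n]_q! = [n]_q ⋯ [1]_q`. -/
noncomputable def qFact (n : ℕ) : K := ∏ i ∈ Finset.range n, qInt (i + 1)

lemma isUnit_qFact (n : ℕ) : IsUnit (qFact n) := by
  rw [qFact]
  refine Finset.prod_induction _ IsUnit (fun _ _ => IsUnit.mul) isUnit_one fun i _ => ?_
  rw [PowerSeries.isUnit_iff_constantCoeff, qInt, map_sum]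
  have hq : PowerSeries.constantCoeff q = 1 := by
    rw [← PowerSeries.coeff_zero_eq_constantCoeff_apply]
    exact coeff_zero_expSeries _
  simp only [map_pow, hq, one_pow, Finset.sum_const, Finset.card_range, nsmul_eq_mul, mul_one]
  have : ((i + 1 : ℕ) : Qe) = algebraMap ℚ Qe ((i + 1 : ℕ) : ℚ) := by simp
  rw [this]
  exact (isUnit_iff_ne_zero.2 (by positivity)).map _

/-- The element `b = t + εa`. -/
noncomputable def bD : D := gD Gen.t + eps • gD Gen.a

/-- The universal `R`-matrix
`R = ∑_{m,n} h^{m+n} / ([m]_q! n!) (yᵐ bⁿ) ⊗ (aⁿ xᵐ)`. -/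
noncomputable def RD : DD :=
  hEval (PowerSeries.mk fun N => ∑ p ∈ Finset.HasAntidiagonal.antidiagonal N,
    Ring.inverse (qFact p.1) • ((p.2)! : ℚ)⁻¹ •
      toDD ((gD Gen.y ^ p.1 * bD ^ p.2) ⊗ₜ[K] (gD Gen.a ^ p.2 * gD Gen.x ^ p.1)))

end RMatrix

section Maps

/-- The unique `ℚ[ε][[h]]`-linear extension to `𝔻 ⊗̂ 𝔻` of a linear map on `𝔻 ⊗ 𝔻`. -/
noncomputable def extendDD {P : Type*} [AddCommGroup P] [Module K P] [IsAdicComplete hI P]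
    (f : D ⊗[K] D →ₗ[K] P) : DD →ₗ[K] P :=
  (extend (P := P) f : AdicCompletion hI (D ⊗[K] D) →ₗ[K] P)

lemma extendDD_toDD {P : Type*} [AddCommGroup P] [Module K P] [IsAdicComplete hI P]
    (f : D ⊗[K] D →ₗ[K] P) (z : D ⊗[K] D) : extendDD f (toDD z) = f z :=
  extend_of f z

/-- The unique bilinear extension to `𝔻 ⊗̂ 𝔻` of a bilinear map on `𝔻 ⊗ 𝔻`. -/
noncomputable def extendDD₂ {P : Type*} [AddCommGroup P] [Module K P] [IsAdicComplete hI P]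
    (f : D ⊗[K] D →ₗ[K] D ⊗[K] D →ₗ[K] P) : DD →ₗ[K] DD →ₗ[K] P :=
  (extend₂ (P := P) f :
    AdicCompletion hI (D ⊗[K] D) →ₗ[K] AdicCompletion hI (D ⊗[K] D) →ₗ[K] P)

lemma extendDD₂_toDD {P : Type*} [AddCommGroup P] [Module K P] [IsAdicComplete hI P]
    (f : D ⊗[K] D →ₗ[K] D ⊗[K] D →ₗ[K] P) (z w : D ⊗[K] D) :
    extendDD₂ f (toDD z) (toDD w) = f z w :=
  extend₂_of f z w

/-- The cross map `Cr(x ⊗ y) = ∑ xαᵢ ⊗ βᵢy = (x ⊗ 1) R (1 ⊗ y)`, for `R = ∑ αᵢ ⊗ βᵢ`. -/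
noncomputable def Cr : DD →ₗ[K] DD :=
  extendDD (TensorProduct.lift (((LinearMap.mul K DD).compl₁₂
    (LinearMap.mulRight K RD ∘ₗ inl.toLinearMap) inr.toLinearMap)))

lemma Cr_toDD (x y : D) : Cr (toDD (x ⊗ₜ[K] y)) = inl x * RD * inr y := by
  rw [Cr, extendDD_toDD]
  rfl

/-- The bilinear map `(x₁ ⊗ x₂, y₁ ⊗ y₂) ↦ x₂ S(y₁) κ S(x₁) κ y₂`. -/
noncomputable def sandwich : D ⊗[K] D →ₗ[K] D ⊗[K] D →ₗ[K] D :=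
  TensorProduct.lift (LinearMap.mk₂ K
    (fun x₁ x₂ => TensorProduct.lift (LinearMap.mk₂ K
      (fun y₁ y₂ => x₂ * antipode y₁ * kappa * antipode x₁ * kappa * y₂)
      (fun _ _ _ => by simp only [map_add, mul_add, add_mul])
      (fun _ _ _ => by simp only [map_smul, mul_smul_comm, smul_mul_assoc])
      (fun _ _ _ => by simp only [mul_add])
      (fun _ _ _ => by simp only [mul_smul_comm])))
    (fun _ _ _ => TensorProduct.ext' fun _ _ => by
      simp only [TensorProduct.lift.tmul, LinearMap.mk₂_apply, LinearMap.add_apply, map_add,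
        mul_add, add_mul])
    (fun _ _ _ => TensorProduct.ext' fun _ _ => by
      simp only [TensorProduct.lift.tmul, LinearMap.mk₂_apply, LinearMap.smul_apply, map_smul,
        mul_smul_comm, smul_mul_assoc])
    (fun _ _ _ => TensorProduct.ext' fun _ _ => by
      simp only [TensorProduct.lift.tmul, LinearMap.mk₂_apply, LinearMap.add_apply, add_mul])
    (fun _ _ _ => TensorProduct.ext' fun _ _ => by
      simp only [TensorProduct.lift.tmul, LinearMap.mk₂_apply, LinearMap.smul_apply,
        smul_mul_assoc]))

lemma sandwich_tmul (x₁ x₂ y₁ y₂ : D) : sandwich (x₁ ⊗ₜ[K] x₂) (y₁ ⊗ₜ[K] y₂)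
    = x₂ * antipode y₁ * kappa * antipode x₁ * kappa * y₂ := by
  simp [sandwich]

/-- The band map `B : 𝔻 ⊗̂ 𝔻 → 𝔻`,
`B(x ⊗ y) = ∑ x₍₂₎ S(y₍₁₎) κ S(x₍₁₎) κ y₍₂₎`. -/
noncomputable def B : DD →ₗ[K] D :=
  extendDD (TensorProduct.lift
    ((extendDD₂ sandwich).compl₁₂ comul.toLinearMap comul.toLinearMap))

lemma B_toDD (x y : D) : B (toDD (x ⊗ₜ[K] y)) = extendDD₂ sandwich (comul x) (comul y) := by
  rw [B, extendDD_toDD]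
  rfl

/-- The completed tensor power `M^{⊗̂ n}` of a module. -/
abbrev TP (M : Type) [AddCommGroup M] [Module K M] (n : ℕ) : Type :=
  AdicCompletion hI (⨂[K] _ : Fin n, M)

/-- The map `f^{⊗̂ n} : M^{⊗̂ n} → N^{⊗̂ n}`. -/
noncomputable def mapTP {M N : Type} [AddCommGroup M] [Module K M] [AddCommGroup N] [Module K N]
    (n : ℕ) (f : M →ₗ[K] N) : TP M n →ₗ[K] TP N n :=
  extend (AdicCompletion.of hI (⨂[K] _ : Fin n, N) ∘ₗ PiTensorProduct.map fun _ => f)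

/-- The family `u₁ ⊗ u₂, u₃ ⊗ u₄, …, u_{2g-1} ⊗ u_{2g}`. -/
noncomputable def pairs (g : ℕ) (u : Fin (2 * g) → D) (i : Fin g) : DD :=
  toDD (u ⟨2 * i, by omega⟩ ⊗ₜ[K] u ⟨2 * i + 1, by omega⟩)

lemma exists_pairs_update {g : ℕ} [DecidableEq (Fin (2 * g))] (u : Fin (2 * g) → D)
    (j : Fin (2 * g)) : ∃ L : D →ₗ[K] DD, ∀ v : D, pairs g (Function.update u j v)
      = Function.update (pairs g u) ⟨j / 2, by omega⟩ (L v) := by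
  obtain ⟨j, hj⟩ := j
  rcases Nat.even_or_odd' j with ⟨c, rfl | rfl⟩
  · refine ⟨toDD.toLinearMap ∘ₗ (TensorProduct.mk K D D).flip (u ⟨2 * c + 1, by omega⟩),
      fun v => funext fun i => ?_⟩
    by_cases hi : (i : ℕ) = c
    · subst hi
      simp [pairs, Function.update_apply]
    · have h1 : ¬ 2 * (i : ℕ) + 1 = 2 * c := by omega
      have h2 : ¬ (i : ℕ) = c := hi
      simp [pairs, Fin.ext_iff, h1, h2]
  · refine ⟨toDD.toLinearMap ∘ₗ TensorProduct.mk K D D (u ⟨2 * c, by omega⟩),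
      fun v => funext fun i => ?_⟩
    have hc : (2 * c + 1) / 2 = c := by omega
    by_cases hi : (i : ℕ) = c
    · subst hi
      simp [pairs, Function.update_apply, hc]
    · have h1 : ¬ 2 * (i : ℕ) = 2 * c + 1 := by omega
      have h2 : ¬ (i : ℕ) = c := hi
      simp [pairs, Fin.ext_iff, h1, h2, hc]

/-- The canonical isomorphism `𝔻^{⊗̂ 2g} → (𝔻 ⊗̂ 𝔻)^{⊗̂ g}`,
`u₁ ⊗ u₂ ⊗ ⋯ ⊗ u_{2g} ↦ (u₁ ⊗ u₂) ⊗ ⋯ ⊗ (u_{2g-1} ⊗ u_{2g})`. -/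
noncomputable def pairTP (g : ℕ) : TP D (2 * g) →ₗ[K] TP DD g :=
  extend (AdicCompletion.of hI (⨂[K] _ : Fin g, DD) ∘ₗ PiTensorProduct.lift
    { toFun := fun u => PiTensorProduct.tprod K (pairs g u)
      map_update_add' := fun u j v w => by
        obtain ⟨L, hL⟩ := exists_pairs_update u j
        simp only [hL, map_add, MultilinearMap.map_update_add]
      map_update_smul' := fun u j c v => by
        obtain ⟨L, hL⟩ := exists_pairs_update u j
        simp only [hL, map_smul, MultilinearMap.map_update_smul] })

lemma pairTP_of (g : ℕ) (u : Fin (2 * g) → D) :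
    pairTP g (AdicCompletion.of hI _ (PiTensorProduct.tprod K u))
      = AdicCompletion.of hI _ (PiTensorProduct.tprod K (pairs g u)) := by
  rw [pairTP, extend_of, LinearMap.comp_apply, PiTensorProduct.lift.tprod]
  rfl

lemma mapTP_of {M N : Type} [AddCommGroup M] [Module K M] [AddCommGroup N] [Module K N]
    (n : ℕ) (f : M →ₗ[K] N) (u : Fin n → M) :
    mapTP n f (AdicCompletion.of hI _ (PiTensorProduct.tprod K u))
      = AdicCompletion.of hI _ (PiTensorProduct.tprod K fun i => f (u i)) := by
  rw [mapTP, extend_of, LinearMap.comp_apply, PiTensorProduct.map_tprod]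

/-- The `n`-fold multiplication `μ^{[n]} : 𝔻^{⊗̂ n} → 𝔻`. -/
noncomputable def mulTP (n : ℕ) : TP D n →ₗ[K] D :=
  extend (PiTensorProduct.lift (MultilinearMap.mkPiAlgebraFin K n D))

lemma mulTP_of (n : ℕ) (u : Fin n → D) :
    mulTP n (AdicCompletion.of hI _ (PiTensorProduct.tprod K u)) = (List.ofFn u).prod := by
  rw [mulTP, extend_of, PiTensorProduct.lift.tprod, MultilinearMap.mkPiAlgebraFin_apply]

/-- The algebraic thickening map `Th = μ^{[g]} ∘ B^{⊗̂ g} ∘ Cr^{⊗̂ g} : 𝔻^{⊗̂ 2g} → 𝔻`. -/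
noncomputable def Th (g : ℕ) : TP D (2 * g) →ₗ[K] D :=
  mulTP g ∘ₗ mapTP g B ∘ₗ mapTP g Cr ∘ₗ pairTP g

lemma Th_of (g : ℕ) (u : Fin (2 * g) → D) :
    Th g (AdicCompletion.of hI _ (PiTensorProduct.tprod K u))
      = (List.ofFn fun i => B (Cr (pairs g u i))).prod := by
  simp only [Th, LinearMap.comp_apply, pairTP_of, mapTP_of, mulTP_of]

end Maps

section Ordering

/-- The ordering map on polynomials, `yᵏ tˡ aᵖ xʳ ↦ yᵏ tˡ aᵖ xʳ`, with values in the free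
algebra. -/
noncomputable def ordFree : MvPolynomial Gen Qe →ₗ[Qe] Free :=
  (MvPolynomial.basisMonomials Gen Qe).constr Qe fun m : Gen →₀ ℕ =>
    FreeAlgebra.ι Qe Gen.y ^ m Gen.y * FreeAlgebra.ι Qe Gen.t ^ m Gen.t *
      FreeAlgebra.ι Qe Gen.a ^ m Gen.a * FreeAlgebra.ι Qe Gen.x ^ m Gen.x

/-- The ordering map `𝒪 : ℚ[ε][y, t, a, x][[h]] → 𝔻`,
`∑ₙ fₙ hⁿ ↦ ∑ₙ 𝒪(fₙ) hⁿ` with `𝒪(yᵏ tˡ aᵖ xʳ) = yᵏ tˡ aᵖ xʳ`. -/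
noncomputable def ord (f : PowerSeries (MvPolynomial Gen Qe)) : D :=
  toD (PowerSeries.mk fun n => ordFree (PowerSeries.coeff n f))

lemma ordFree_monomial (m : Gen →₀ ℕ) (c : Qe) : ordFree (MvPolynomial.monomial m c)
    = c • (FreeAlgebra.ι Qe Gen.y ^ m Gen.y * FreeAlgebra.ι Qe Gen.t ^ m Gen.t *
      FreeAlgebra.ι Qe Gen.a ^ m Gen.a * FreeAlgebra.ι Qe Gen.x ^ m Gen.x) := by
  have : MvPolynomial.monomial m c = c • MvPolynomial.basisMonomials Gen Qe m := by
    rw [MvPolynomial.coe_basisMonomials, MvPolynomial.smul_monomial, smul_eq_mul, mul_one]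
  rw [this, map_smul, ordFree, Module.Basis.constr_basis]

lemma ord_monomial (m : Gen →₀ ℕ) (c : Qe) (n : ℕ) :
    ord (PowerSeries.monomial n (MvPolynomial.monomial m c))
      = (h ^ n * PowerSeries.C c) • (gD Gen.y ^ m Gen.y * gD Gen.t ^ m Gen.t *
        gD Gen.a ^ m Gen.a * gD Gen.x ^ m Gen.x) := by
  simp only [gD, ← map_pow, ← map_mul, ← map_smul, ord]
  congr 1
  rw [mul_smul, h_pow_smul_freeH, Algebra.smul_def, algebraMap_freeH, PowerSeries.map_C]
  ext k
  simp only [gen, ← map_pow, ← map_mul, PowerSeries.coeff_mk, PowerSeries.coeff_monomial,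
    PowerSeries.coeff_X_pow_mul', PowerSeries.coeff_C]
  by_cases hk : k = n
  · subst hk
    simp [ordFree_monomial, Algebra.smul_def]
  · rw [if_neg hk, map_zero]
    split_ifs <;> first | rfl | omega

/-- The coefficient of `f` at the monomial `m ε^j h^n`. -/
noncomputable def monCoeff (f : PowerSeries (MvPolynomial Gen Qe)) (m : Gen →₀ ℕ) (j n : ℕ) : ℚ :=
  ((PowerSeries.coeff n f).coeff m).coeff j

/-- All monomials `yᵏ tˡ aᵖ xʳ ε^j hⁿ` that occur in `f` satisfy `p ≤ j`. -/
def Star (f : PowerSeries (MvPolynomial Gen Qe)) : Prop :=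
  ∀ (m : Gen →₀ ℕ) (j n : ℕ), monCoeff f m j n ≠ 0 → m Gen.a ≤ j

/-- The subring `ℚ[[h]]` of `ℚ[ε][[h]]`. -/
noncomputable def Qh : Subring K := (PowerSeries.map (Polynomial.C : ℚ →+* Qe)).range

/-- The `ℚ[[h]]`-span of the monomials `yᵏ tˡ a^{n+j} xʳ εⁿ`, for `k, l, r ≥ 0`. -/
noncomputable def badSpan (n j : ℕ) : Submodule Qh D :=
  Submodule.span Qh {w | ∃ k l r : ℕ, w = eps ^ n •
    (gD Gen.y ^ k * gD Gen.t ^ l * gD Gen.a ^ (n + j) * gD Gen.x ^ r)}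

end Ordering
end BandMap

/-! The `a`-degree of a monomial is bounded by its `ε`-degree because the image of `B` lies in
`redD`, the closed subalgebra generated by `y`, `t`, `εa`, `x`. Two independent facts are needed.

Ordering. Modulo `h` the relations only exchange `y` and `x` at the cost of a polynomial in `t` and
`a`, and exchange `a` with `x` or `y` at the cost of a scalar multiple of `x` or `y`. So every
element is an ordered expression modulo `h`, and iteration makes it an `h`-adic limit of ordered
ones (`OrderRels.closedAdjoin_le`). For `y`, `t`, `a`, `x` this gives surjectivity of `ord`. The
same argument applies to `y`, `t`, `εa`, `x`, since `(1 - A²T)/h` is `t + 2εa` modulo `h`: elements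
of `redD` are limits of combinations of `yᵏ tˡ (εa)ᵖ xʳ`, which have the required shape. Reading off
coefficients needs injectivity of `ord`, which comes from a representation of `𝔻` on formal ordered
words: the image of the word `1` under `ord f` gives back `f` (`eval_rep_ord`).

Band map. The elements `A`, `T`, `κ` are exponentials in `εa` and `t`, so `Δ`, `S` and the products
in `B` preserve `redD`; the only generator outside is `a`. Since `[a, redD] ⊆ redD`, powers of `a`
can be collected on the right of the first argument and on the left of the second. In `B(u aᵖ ⊗ aˢ
w)` each such `a` disappears: `Δ(a) = a ⊗ 1 + 1 ⊗ a`, `S(a) = -a` and `aκ = κa` turn its two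
occurrences into a commutator with `a ⊗ 1` in the other argument (`sandwich_mul_comul_a`,
`sandwich_comul_a_mul`), and this commutator preserves the tensor version `redDD` of `redD`. Hence
`B_mem_redD`. The values of `Th` are limits of combinations of products of values of `B`, so they
lie in `redD` as well, whatever the `R`-matrix in `Cr` is. -/

namespace BandMap

open scoped TensorProduct Nat

/-! ### Closures in the `h`-adic topology. -/

section Closure

variable {M : Type*} [AddCommGroup M] [Module K M] {P : Type*} [AddCommGroup P] [Module K P]

/-- The closure of a submodule in the `h`-adic topology. -/
def hClosure (N : Submodule K M) : Submodule K M where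
  carrier := {m | ∀ n : ℕ, ∃ s ∈ N, ∃ r : M, m = s + h ^ n • r}
  zero_mem' _ := ⟨0, N.zero_mem, 0, by simp⟩
  add_mem' := by
    intro m m' hm hm' n
    obtain ⟨s, hs, r, rfl⟩ := hm n
    obtain ⟨s', hs', r', rfl⟩ := hm' n
    exact ⟨s + s', N.add_mem hs hs', r + r', by rw [smul_add]; abel⟩
  smul_mem' := by
    intro c m hm n
    obtain ⟨s, hs, r, rfl⟩ := hm n
    exact ⟨c • s, N.smul_mem c hs, c • r, by rw [smul_add, smul_comm c]⟩

lemma le_hClosure (N : Submodule K M) : N ≤ hClosure N :=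
  fun m hm _ => ⟨m, hm, 0, by simp⟩

/-- Closures are closed: an approximant in `hClosure N` can be replaced by one in `N` at the same
precision. -/
lemma mem_hClosure_of_approx {N : Submodule K M} {m : M}
    (H : ∀ n : ℕ, ∃ s ∈ hClosure N, ∃ r : M, m = s + h ^ n • r) : m ∈ hClosure N := by
  intro n
  obtain ⟨s, hs, r, rfl⟩ := H n
  obtain ⟨s', hs', r', rfl⟩ := hs n
  exact ⟨s', hs', r' + r, by rw [smul_add]; abel⟩

/-- Continuity is automatic: a `K`-linear map sends multiples of `hⁿ` to multiples of `hⁿ`. -/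
lemma map_mem_hClosure (L : M →ₗ[K] P) {N : Submodule K M} {N' : Submodule K P}
    (H : ∀ s ∈ N, L s ∈ hClosure N') {m : M} (hm : m ∈ hClosure N) : L m ∈ hClosure N' := by
  refine mem_hClosure_of_approx fun n => ?_
  obtain ⟨s, hs, r, rfl⟩ := hm n
  exact ⟨L s, H s hs, L r, by rw [map_add, map_smul]⟩

lemma map_mem_hClosure_of_span (L : M →ₗ[K] P) {S : Set M} {N' : Submodule K P}
    (H : ∀ s ∈ S, L s ∈ hClosure N') {m : M} (hm : m ∈ hClosure (Submodule.span K S)) :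
    L m ∈ hClosure N' := by
  refine map_mem_hClosure L (fun s hs => ?_) hm
  have : Submodule.span K S ≤ (hClosure N').comap L := Submodule.span_le.2 H
  exact this hs

/-- Density of a module in its completion. It reduces claims about `B` and `Th` to uncompleted
tensors. -/
lemma mem_hClosure_range_of (z : AdicCompletion hI M) :
    z ∈ hClosure (LinearMap.range (AdicCompletion.of hI M)) := by
  intro n
  obtain ⟨x, hx⟩ := Submodule.Quotient.mk_surjective _ (AdicCompletion.eval hI M n z)
  have : z - AdicCompletion.of hI M x ∈ (hI ^ n • ⊤ : Submodule K (AdicCompletion hI M)) := by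
    rw [AdicCompletion.pow_smul_top_eq_ker_eval ⟨{h}, by simp⟩, LinearMap.mem_ker, map_sub, ← hx]
    simp
  obtain ⟨r, hr⟩ := (mem_hI_pow n _).1 this
  exact ⟨_, ⟨x, rfl⟩, r, by rw [← hr]; abel⟩

variable {C : Type*} [Ring C] [Algebra K C]

/-- The closure of a subalgebra in the `h`-adic topology. -/
noncomputable def hClosureAlg (U : Subalgebra K C) : Subalgebra K C :=
  (hClosure (Subalgebra.toSubmodule U)).toSubalgebra (le_hClosure _ U.one_mem) (by
    intro u w hu hw n
    obtain ⟨s, hs, r, rfl⟩ := hu n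
    obtain ⟨s', hs', r', rfl⟩ := hw n
    refine ⟨s * s', U.mul_mem hs hs', s * r' + r * s' + h ^ n • (r * r'), ?_⟩
    simp only [add_mul, mul_add, smul_add, smul_mul_assoc, mul_smul_comm]
    abel)

lemma le_hClosureAlg (U : Subalgebra K C) : U ≤ hClosureAlg U :=
  le_hClosure (Subalgebra.toSubmodule U)

lemma rat_smul_mem [Algebra ℚ C] {U : Subalgebra K C} {u : C} (hu : u ∈ U) (c : ℚ) :
    c • u ∈ U := by
  have := map_rat_smul (LinearMap.toSpanSingleton K C u) c 1
  simp only [LinearMap.toSpanSingleton_apply, one_smul] at this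
  rw [← this]
  exact U.smul_mem hu _

lemma coeff_expSeries_mem [Algebra ℚ C] {U : Subalgebra K C} {u : C} (hu : u ∈ U) (n : ℕ) :
    PowerSeries.coeff n (expSeries u) ∈ U := by
  rw [expSeries, PowerSeries.coeff_mk]
  exact rat_smul_mem (U.pow_mem hu n) _

variable [IsAdicComplete hI C]

lemma hSum_mem_hClosureAlg {U : Subalgebra K C} {f : PowerSeries C}
    (hf : ∀ n, PowerSeries.coeff n f ∈ hClosureAlg U) : hSum f ∈ hClosureAlg U := by
  refine mem_hClosure_of_approx fun n => ?_
  obtain ⟨r, hr⟩ := hSum_spec f n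
  refine ⟨∑ i ∈ Finset.range n, h ^ i • PowerSeries.coeff i f,
    Submodule.sum_mem _ fun i _ => Submodule.smul_mem _ _ (hf i), -r, ?_⟩
  rw [smul_neg, ← hr]
  abel

variable [Algebra ℚ C]

lemma hExp_mem {U : Subalgebra K C} {u : C} (hu : u ∈ hClosureAlg U) :
    hExp u ∈ hClosureAlg U :=
  hSum_mem_hClosureAlg fun n => coeff_expSeries_mem hu n

/-- The series `(1 - e^{uX})/X` starts with `-u`, and its further coefficients are rational
multiples of powers of `u`. That the remainder stays in the closed subalgebra is what allows the
reordering to be iterated. -/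
lemma hQuot_eq {U : Subalgebra K C} {u : C} (hu : u ∈ hClosureAlg U) :
    ∃ r ∈ hClosureAlg U, hQuot u = -u + h • r := by
  refine ⟨hSum (shift (shift (1 - expSeries u))), hSum_mem_hClosureAlg fun n => ?_, ?_⟩
  · simp only [shift, PowerSeries.coeff_mk, map_sub]
    refine Subalgebra.sub_mem _ ?_ (coeff_expSeries_mem hu _)
    simp [PowerSeries.coeff_one, zero_mem]
  · rw [hQuot, hEval_apply]
    conv_lhs => rw [eq_C_add_X_mul_shift (shift (1 - expSeries u))]
    rw [hSum_add, hSum_C, hSum_X_mul]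
    congr 1
    simp [shift, expSeries, PowerSeries.coeff_one]

end Closure

end BandMap

namespace BandMap

open scoped TensorProduct Nat

/-! ### Representations of `𝔻` by power series of operators. -/

section Operators

variable {R : Type*} [Ring R] [Algebra Qe R]

variable (R) in
/-- Power series over a `ℚ[ε]`-algebra, as an algebra over `ℚ[ε][[h]]`. -/
noncomputable abbrev algebraPowerSeries : Algebra K (PowerSeries R) where
  algebraMap := PowerSeries.map (algebraMap Qe R)
  smul r f := PowerSeries.map (algebraMap Qe R) r * f
  smul_def' _ _ := rfl
  commutes' r f := by
    ext1 n
    rw [PowerSeries.coeff_mul, PowerSeries.coeff_mul, ← Finset.Nat.sum_antidiagonal_swap]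
    refine Finset.sum_congr rfl fun p _ => ?_
    simp only [PowerSeries.coeff_map, Prod.fst_swap, Prod.snd_swap]
    exact Algebra.commutes _ _

attribute [local instance] algebraPowerSeries

lemma algebraMap_powerSeries (r : K) :
    algebraMap K (PowerSeries R) r = PowerSeries.map (algebraMap Qe R) r := rfl

lemma h_pow_smul_powerSeries (n : ℕ) (f : PowerSeries R) :
    h ^ n • f = PowerSeries.X ^ n * f := by
  rw [Algebra.smul_def, algebraMap_powerSeries, map_pow, PowerSeries.map_X]

lemma isAdicComplete_powerSeries : IsAdicComplete hI (PowerSeries R) := by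
  apply isAdicComplete_of
  · intro x hx
    ext1 n
    obtain ⟨r, rfl⟩ := hx (n + 1)
    rw [h_pow_smul_powerSeries, PowerSeries.coeff_X_pow_mul', if_neg (by omega), map_zero]
  · intro c
    refine ⟨PowerSeries.mk fun m => PowerSeries.coeff m
      (∑ i ∈ Finset.range (m + 1), h ^ i • c i), fun n => ?_⟩
    suffices PowerSeries.X ^ n ∣ ((∑ i ∈ Finset.range n, h ^ i • c i) - PowerSeries.mk fun m =>
        PowerSeries.coeff m (∑ i ∈ Finset.range (m + 1), h ^ i • c i)) by
      obtain ⟨r, hr⟩ := this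
      exact ⟨r, by rw [hr, h_pow_smul_powerSeries]⟩
    rw [PowerSeries.X_pow_dvd_iff]
    intro m hm
    obtain ⟨k, rfl⟩ := Nat.exists_eq_add_of_le (Nat.succ_le_of_lt hm)
    rw [map_sub, PowerSeries.coeff_mk, sub_eq_zero, Nat.succ_eq_add_one, Finset.sum_range_add,
      map_add, add_eq_left, map_sum]
    refine Finset.sum_eq_zero fun i _ => ?_
    rw [h_pow_smul_powerSeries, PowerSeries.coeff_X_pow_mul', if_neg (by omega)]

attribute [local instance] isAdicComplete_powerSeries

/-- Evaluating the outer variable at `h` identifies it with the inner one, so coefficients are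
summed along an antidiagonal. -/
lemma coeff_hSum_powerSeries (f : PowerSeries (PowerSeries R)) (n : ℕ) :
    PowerSeries.coeff n (hSum f)
      = ∑ i ∈ Finset.range (n + 1), PowerSeries.coeff (n - i) (PowerSeries.coeff i f) := by
  obtain ⟨r, hr⟩ := hSum_spec f (n + 1)
  have := congrArg (PowerSeries.coeff n) hr
  rw [h_pow_smul_powerSeries, PowerSeries.coeff_X_pow_mul', if_neg (by omega), map_sub,
    sub_eq_zero, map_sum] at this
  rw [← this]
  refine Finset.sum_congr rfl fun i hi => ?_
  rw [h_pow_smul_powerSeries, PowerSeries.coeff_X_pow_mul',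
    if_pos (Nat.lt_succ_iff.1 (Finset.mem_range.1 hi))]

lemma coeff_shift_one_sub (f : PowerSeries R) (n : ℕ) :
    PowerSeries.coeff n (shift (1 - f)) = -PowerSeries.coeff (n + 1) f := by
  simp [shift, PowerSeries.coeff_one]

lemma hSum_map_C (f : PowerSeries R) : hSum (PowerSeries.map PowerSeries.C f) = f := by
  ext1 n
  rw [coeff_hSum_powerSeries, Finset.sum_eq_single n]
  · simp
  · intro i hi hn
    have := Finset.mem_range.1 hi
    rw [PowerSeries.coeff_map, PowerSeries.coeff_C, if_neg (by omega)]
  · intro H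
    exact absurd (Finset.self_mem_range_succ n) H

variable [Algebra ℚ R]

/-- When `t` and `a` do not involve `h`, the completed quotient is the formal series itself, so the
last relation can be checked one coefficient at a time. -/
lemma hQuot_wexp_C (t a : R) : hQuot (wexp (PowerSeries.C t) (PowerSeries.C a))
    = shift (1 - expSeries (-((Polynomial.X : Qe) • (a + a) + t))) := by
  have hw : wexp (PowerSeries.C t) (PowerSeries.C a)
      = PowerSeries.C (-((Polynomial.X : Qe) • (a + a) + t)) := by
    rw [wexp, Algebra.smul_def, algebraMap_powerSeries, PowerSeries.map_C, Algebra.smul_def]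
    simp only [map_neg, map_add, map_mul]
  rw [hQuot, hEval_apply, hw, ← map_expSeries, ← map_one (PowerSeries.map PowerSeries.C),
    ← map_sub, ← map_shift, hSum_map_C]

variable (R) in
/-- Operators that satisfy the defining relations of `𝔻`, where `x` is a power series in `h`. -/
structure OperatorData where
  /-- The operator `y`. -/
  y : R
  /-- The operator `t`. -/
  t : R
  /-- The operator `a`. -/
  a : R
  /-- The coefficients of the operator `x`. -/
  x : ℕ → R
  t_y : t * y = y * t
  t_a : t * a = a * t
  t_x : ∀ n, t * x n = x n * t
  a_y : a * y = y * a - y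
  a_x : ∀ n, a * x n = x n * a + x n
  x_y : ∀ n, x n * y = (∑ p ∈ Finset.HasAntidiagonal.antidiagonal n,
      algebraMap Qe R (PowerSeries.coeff p.1 q) * (y * x p.2)) +
    PowerSeries.coeff n (shift (1 - expSeries (-((Polynomial.X : Qe) • (a + a) + t))))

variable (d : OperatorData R)

/-- The generators of `𝔻`, as power series of operators. -/
noncomputable def OperatorData.gen : Gen → PowerSeries R
  | Gen.y => PowerSeries.C d.y
  | Gen.t => PowerSeries.C d.t
  | Gen.a => PowerSeries.C d.a
  | Gen.x => PowerSeries.mk d.x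

lemma OperatorData.rels : Rels d.gen where
  t_comm g := by
    cases g with
    | y => exact Commute.map (show Commute d.t d.y from d.t_y) PowerSeries.C
    | t => exact Commute.refl _
    | a => exact Commute.map (show Commute d.t d.a from d.t_a) PowerSeries.C
    | x =>
      refine PowerSeries.ext fun n => ?_
      simp only [gen, PowerSeries.coeff_C_mul, PowerSeries.coeff_mul_C, PowerSeries.coeff_mk, d.t_x]
  a_x := by
    refine PowerSeries.ext fun n => ?_
    simp only [gen, map_add, PowerSeries.coeff_C_mul, PowerSeries.coeff_mul_C,
      PowerSeries.coeff_mk, d.a_x]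
  a_y := by simp only [gen, ← map_mul, d.a_y, map_sub]
  x_y := by
    refine PowerSeries.ext fun n => ?_
    simp only [gen]
    rw [hQuot_wexp_C, PowerSeries.coeff_mul_C, PowerSeries.coeff_mk, d.x_y, map_add,
      Algebra.smul_def q, algebraMap_powerSeries, PowerSeries.coeff_mul]
    simp only [PowerSeries.coeff_map, PowerSeries.coeff_C_mul, PowerSeries.coeff_mk]

/-- The representation of `𝔻` by power series of operators. -/
noncomputable def OperatorData.rep : D →ₐ[K] PowerSeries R := liftD d.gen d.rels

lemma OperatorData.evalFree_monomial (m : Gen →₀ ℕ) (c : Qe) :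
    evalFree d.gen (ordFree (MvPolynomial.monomial m c))
      = PowerSeries.C (algebraMap Qe R c * (d.y ^ m Gen.y * d.t ^ m Gen.t * d.a ^ m Gen.a)) *
        PowerSeries.mk d.x ^ m Gen.x := by
  rw [ordFree_monomial, Algebra.smul_def, map_mul, evalFree_algebraMap, algebraMap_powerSeries,
    PowerSeries.map_C]
  simp only [map_mul, map_pow, evalFree_ι, gen, mul_assoc]

lemma OperatorData.coeff_rep_ord (f : PowerSeries (MvPolynomial Gen Qe)) (n : ℕ) :
    PowerSeries.coeff n (d.rep (ord f)) = ∑ i ∈ Finset.range (n + 1),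
      PowerSeries.coeff (n - i) (evalFree d.gen (ordFree (PowerSeries.coeff i f))) := by
  rw [rep, ord, liftD_toD, evalFreeH_apply, hEval_apply, coeff_hSum_powerSeries]
  simp only [PowerSeries.coeff_map, PowerSeries.coeff_mk]

end Operators

/-! ### The action of `𝔻` on ordered words and the injectivity of `ord`. -/

section Representation

attribute [local instance] algebraPowerSeries

lemma monomial_gen (m : Gen →₀ ℕ) (c : Qe) : MvPolynomial.monomial m c
    = c • (MvPolynomial.X Gen.y ^ m Gen.y * (MvPolynomial.X Gen.t ^ m Gen.t *
      (MvPolynomial.X Gen.a ^ m Gen.a * MvPolynomial.X Gen.x ^ m Gen.x))) := by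
  have hm : m = Finsupp.single Gen.y (m Gen.y) + (Finsupp.single Gen.t (m Gen.t) +
      (Finsupp.single Gen.a (m Gen.a) + Finsupp.single Gen.x (m Gen.x))) := by
    ext g
    cases g <;> simp
  conv_lhs => rw [hm]
  simp only [MvPolynomial.X_pow_eq_monomial, MvPolynomial.monomial_mul, MvPolynomial.smul_monomial,
    mul_one, smul_eq_mul]


variable (Q : Type) [CommRing Q] [Algebra Qe Q]

/-- The space on which `𝔻` is represented, with elements `∑ yᵏ gₖ`, where the `gₖ` are in a
commutative algebra of symbols in `t`, `a`, `x`. -/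
def RepSpace : Type := ℕ →₀ Q

noncomputable instance : AddCommGroup (RepSpace Q) := inferInstanceAs (AddCommGroup (ℕ →₀ Q))

noncomputable instance : Module Qe (RepSpace Q) := inferInstanceAs (Module Qe (ℕ →₀ Q))

noncomputable instance [Algebra ℚ Q] : Module ℚ (RepSpace Q) :=
  inferInstanceAs (Module ℚ (ℕ →₀ Q))

variable {Q} {M : Type*} [AddCommGroup M] [Module Qe M]

/-- The element `yᵏ g`. -/
noncomputable def RepSpace.single (k : ℕ) : Q →ₗ[Qe] RepSpace Q := Finsupp.lsingle k

/-- The linear map with given values on the elements `yᵏ g`. -/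
noncomputable def RepSpace.lift (f : ℕ → Q →ₗ[Qe] M) : RepSpace Q →ₗ[Qe] M := Finsupp.lsum Qe f

lemma RepSpace.lift_single (f : ℕ → Q →ₗ[Qe] M) (k : ℕ) (g : Q) :
    RepSpace.lift f (RepSpace.single k g) = f k g :=
  Finsupp.lsum_single Qe f k g

lemma RepSpace.end_ext {u w : Module.End Qe (RepSpace Q)}
    (H : ∀ k g, u (RepSpace.single k g) = w (RepSpace.single k g)) : u = w :=
  Finsupp.lhom_ext H

open RepSpace

variable (Q) in
/-- A commutative algebra of symbols with elements `t`, `a`, `x` and a substitution `a ↦ a - 1`. -/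
structure SymbolData where
  /-- The symbol `t`. -/
  t : Q
  /-- The symbol `a`. -/
  a : Q
  /-- The symbol `x`. -/
  x : Q
  /-- The substitution `a ↦ a - 1`. -/
  shiftA : Q →ₐ[Qe] Q
  shiftA_t : shiftA t = t
  shiftA_a : shiftA a = a - 1
  shiftA_x : shiftA x = x

variable (d : SymbolData Q)

/-- The symbols together with a symbol for `y`. -/
def SymbolData.symbols (y : Q) : Gen → Q
  | Gen.y => y
  | Gen.t => d.t
  | Gen.a => d.a
  | Gen.x => d.x

/-- The exponent of `A²T` after the substitution `a ↦ a - k`. -/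
noncomputable def shiftedWexp (k : ℕ) : Q :=
  -((Polynomial.X : Qe) • ((d.a - (k : Q)) + (d.a - (k : Q))) + d.t)

variable (Q) in
/-- The action of `y`. -/
noncomputable def yOp : Module.End Qe (RepSpace Q) := lift fun k => single (k + 1)

/-- The action of `t`. -/
noncomputable def tOp : Module.End Qe (RepSpace Q) :=
  lift fun k => single k ∘ₗ LinearMap.mulLeft Qe d.t

/-- The action of `a`. -/
noncomputable def aOp : Module.End Qe (RepSpace Q) :=
  -- From `a y = y (a - 1)` one gets `a yᵏ = yᵏ (a - k)`.
  lift fun k => single k ∘ₗ LinearMap.mulLeft Qe (d.a - (k : Q))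

lemma yOp_single (k : ℕ) (g : Q) : yOp Q (single k g) = single (k + 1) g := lift_single _ k g

lemma tOp_single (k : ℕ) (g : Q) : tOp d (single k g) = single k (d.t * g) := lift_single _ k g

lemma aOp_single (k : ℕ) (g : Q) : aOp d (single k g) = single k ((d.a - (k : Q)) * g) :=
  lift_single _ k g

variable [Algebra ℚ Q]

/-- The series `c_k` with `x yᵏ = qᵏ yᵏ x + yᵏ⁻¹ c_k(t, a)`. -/
noncomputable def xyCoeff : ℕ → PowerSeries Q
  | 0 => 0
  -- Write `x yᵏ⁺¹ = (q y x + (1 - A²T)/h) yᵏ`: the last term passes `yᵏ` by the substitution `a ↦ a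
  -- - k`, and `q y (x yᵏ)` contributes `q c_k`.
  | k + 1 => shift (1 - expSeries (shiftedWexp d k)) +
      PowerSeries.map (algebraMap Qe Q) q * xyCoeff k

/-- The coefficients of the action of `x`. -/
noncomputable def xOp (n : ℕ) : Module.End Qe (RepSpace Q) :=
  -- This is `x yᵏ g = qᵏ yᵏ (x g) + yᵏ⁻¹ c_k g` with `x g(a) = g(a - 1) x`. The truncated `k - 1`
  -- at `k = 0` is harmless because `c_0 = 0`.
  lift fun k =>
    single k ∘ₗ (PowerSeries.coeff n (q ^ k) •
      (LinearMap.mulLeft Qe d.x ∘ₗ d.shiftA.toLinearMap)) +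
    single (k - 1) ∘ₗ LinearMap.mulLeft Qe (PowerSeries.coeff n (xyCoeff d k))

lemma xOp_single (n k : ℕ) (g : Q) : xOp d n (single k g)
    = single k (PowerSeries.coeff n (q ^ k) • (d.x * d.shiftA g)) +
      single (k - 1) (PowerSeries.coeff n (xyCoeff d k) * g) := lift_single _ k g

/-- On words `yᵏ g` the operators `a` and `t` are multiplications by `a - k` and `t`, so every power
of the exponent of `A²T` is a multiplication too. -/
lemma expSeries_wexp_single (n k : ℕ) (g : Q) :
    PowerSeries.coeff n (expSeries (-((Polynomial.X : Qe) • (aOp d + aOp d) + tOp d)))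
      (single k g)
      = single k (PowerSeries.coeff n (expSeries (shiftedWexp d k)) * g) := by
  have hw : ∀ g : Q, (-((Polynomial.X : Qe) • (aOp d + aOp d) + tOp d))
      (single k g) = single k (shiftedWexp d k * g) := fun g => by
    simp only [LinearMap.neg_apply, LinearMap.add_apply, LinearMap.smul_apply, aOp_single,
      tOp_single, shiftedWexp, ← map_add, ← map_neg, ← map_smul]
    congr 1
    simp only [smul_add, add_mul, neg_mul, smul_mul_assoc]
  have hp : ((-((Polynomial.X : Qe) • (aOp d + aOp d) + tOp d)) ^ n) (single k g)
      = single k (shiftedWexp d k ^ n * g) := by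
    induction n with
    | zero => simp
    | succ n ih => rw [pow_succ', Module.End.mul_apply, ih, hw, pow_succ', mul_assoc]
  simp only [expSeries, PowerSeries.coeff_mk]
  rw [LinearMap.smul_apply, hp, smul_mul_assoc, map_rat_smul]

/-- The operators on `RepSpace Q`. -/
noncomputable def repData : OperatorData (Module.End Qe (RepSpace Q)) where
  y := yOp Q
  t := tOp d
  a := aOp d
  x := xOp d
  t_y := end_ext fun k g => by simp only [Module.End.mul_apply, tOp_single, yOp_single]
  t_a := end_ext fun k g => by
    simp only [Module.End.mul_apply, tOp_single, aOp_single, mul_left_comm]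
  t_x n := end_ext fun k g => by
    simp only [Module.End.mul_apply, tOp_single, xOp_single, map_add, map_mul, d.shiftA_t,
      ← mul_smul_comm, mul_left_comm]
  a_y := end_ext fun k g => by
    simp only [Module.End.mul_apply, LinearMap.sub_apply, aOp_single, yOp_single, ← map_sub]
    congr 1
    push_cast
    ring
  a_x n := end_ext fun k g => by
    simp only [Module.End.mul_apply, LinearMap.add_apply, aOp_single, xOp_single, map_add]
    have h1 : d.shiftA ((d.a - (k : Q)) * g) = (d.a - 1 - (k : Q)) * d.shiftA g := by
      simp [d.shiftA_a]
    rw [h1]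
    -- At `k = 0` the term with `yᵏ⁻¹` vanishes; otherwise `k - 1` is a true predecessor and the
    -- shift by one in `a` matches the drop in the power of `y`.
    cases k with
    | zero =>
      simp only [xyCoeff, map_zero, zero_mul, mul_zero, add_zero, ← map_add, mul_smul_comm,
        ← smul_add]
      congr 2
      push_cast
      ring
    | succ k =>
      rw [add_add_add_comm, ← map_add, ← map_add, mul_smul_comm, ← smul_add]
      congr 3
      · ring
      · rw [Nat.add_sub_cancel]
        push_cast
        ring
  x_y n := end_ext fun k g => by
    simp only [Module.End.mul_apply, LinearMap.add_apply, LinearMap.sum_apply,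
      Module.algebraMap_end_apply, yOp_single, xOp_single, map_add, smul_add, ← map_smul]
    rw [Finset.sum_add_distrib, pow_succ', Nat.add_sub_cancel, PowerSeries.coeff_mul, add_assoc,
      ← map_sum, ← map_sum]
    simp only [smul_smul, ← Finset.sum_smul]
    congr 1
    rw [coeff_shift_one_sub, LinearMap.neg_apply, ← smul_add, expSeries_wexp_single, ← map_neg,
      xyCoeff, map_add, PowerSeries.coeff_mul, add_comm, add_mul, map_add]
    congr 1
    -- What remains is the recursion for `c_{k+1}`: the part `q c_k` comes from `q y x`, and it is
    -- zero at `k = 0`.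
    · cases k with
      | zero => simp [xyCoeff]
      | succ k =>
        rw [Nat.add_sub_cancel, Finset.sum_mul]
        simp only [PowerSeries.coeff_map, Algebra.smul_def, mul_assoc]
    · rw [coeff_shift_one_sub, neg_mul]

/-- On words without `y` all corrections vanish, as `q⁰ = 1` and `c_0 = 0`; the substitution in `a`
fixes powers of `x`. So `xʳ` acts on `1` without any `h`. -/
lemma coeff_x_pow_single (r n : ℕ) : PowerSeries.coeff n (PowerSeries.mk (xOp d) ^ r) (single 0 1)
    = if n = 0 then single 0 (d.x ^ r) else 0 := by
  induction r generalizing n with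
  | zero =>
    rw [pow_zero, PowerSeries.coeff_one]
    split_ifs <;> simp
  | succ r ih =>
    rw [pow_succ', PowerSeries.coeff_mul, LinearMap.sum_apply]
    simp only [Module.End.mul_apply, ih]
    rw [Finset.sum_eq_single (n, 0)]
    · simp only [PowerSeries.coeff_mk, if_true, xOp_single, xyCoeff, pow_zero,
        PowerSeries.coeff_one]
      split_ifs <;> simp [d.shiftA_x, pow_succ']
    · rintro ⟨i, j⟩ hij hne
      rw [Finset.HasAntidiagonal.mem_antidiagonal] at hij
      have : j ≠ 0 := by
        rintro rfl
        exact hne (by simp_all)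
      simp [this]
    · simp

lemma ops_single (k l p : ℕ) (g : Q) :
    (yOp Q ^ k * tOp d ^ l * aOp d ^ p) (single 0 g) = single k (d.t ^ l * (d.a ^ p * g)) := by
  have ht : ∀ (l : ℕ) g, (tOp d ^ l) (single 0 g) = single 0 (d.t ^ l * g) := fun l g => by
    induction l with
    | zero => simp
    | succ l ih => rw [pow_succ', Module.End.mul_apply, ih, tOp_single, pow_succ', mul_assoc]
  have ha : ∀ (l : ℕ) g, (aOp d ^ l) (single 0 g) = single 0 (d.a ^ l * g) := fun l g => by
    induction l with
    | zero => simp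
    | succ l ih =>
      rw [pow_succ', Module.End.mul_apply, ih, aOp_single, pow_succ', mul_assoc]
      simp
  have hy : ∀ (l : ℕ) g, (yOp Q ^ l) (single 0 g) = single l g := fun l g => by
    induction l with
    | zero => simp
    | succ l ih => rw [pow_succ', Module.End.mul_apply, ih, yOp_single]
  simp only [Module.End.mul_apply]
  rw [ha, ht, hy]

/-- The evaluation `∑ yᵏ gₖ` at an element `y` of `Q`. -/
noncomputable def RepSpace.eval (y : Q) : RepSpace Q →ₗ[Qe] Q :=
  lift fun k => LinearMap.mulLeft Qe (y ^ k)

/-- An ordered monomial applied to the word `1` builds the same monomial: `x` acts first, then `a`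
and `t` while there is no `y`, and `y` last. None of these steps produces a power of `h`. -/
lemma eval_ordFree (y : Q) (p : MvPolynomial Gen Qe) (n : ℕ) :
    RepSpace.eval y (PowerSeries.coeff n (evalFree (repData d).gen (ordFree p)) (single 0 1))
      = if n = 0 then MvPolynomial.aeval (d.symbols y) p else 0 := by
  induction p using MvPolynomial.induction_on' with
  | monomial m c =>
    rw [OperatorData.evalFree_monomial, PowerSeries.coeff_C_mul, Module.End.mul_apply]
    simp only [repData, coeff_x_pow_single]
    split_ifs
    · rw [Module.End.mul_apply, ops_single, Module.algebraMap_end_apply, map_smul, RepSpace.eval,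
        lift_single, monomial_gen, map_smul]
      simp only [map_mul, map_pow, MvPolynomial.aeval_X, SymbolData.symbols,
        LinearMap.mulLeft_apply]
    · simp
  | add p p' hp hp' =>
    rw [map_add, map_add, map_add, LinearMap.add_apply, map_add, hp, hp']
    split_ifs <;> simp

/-- Since ordered polynomials act on `1` in `h`-degree zero only, the antidiagonal sum reduces to
the coefficient of `hⁿ` in `f`. -/
lemma eval_rep_ord (y : Q) (f : PowerSeries (MvPolynomial Gen Qe)) (n : ℕ) :
    RepSpace.eval y (PowerSeries.coeff n ((repData d).rep (ord f)) (single 0 1))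
      = MvPolynomial.aeval (d.symbols y) (PowerSeries.coeff n f) := by
  rw [OperatorData.coeff_rep_ord, LinearMap.sum_apply, map_sum]
  simp only [eval_ordFree]
  rw [Finset.sum_eq_single n]
  · simp
  · intro i hi hn
    have := Finset.mem_range.1 hi
    rw [if_neg (by omega)]
  · intro H
    exact absurd (Finset.self_mem_range_succ n) H

end Representation

/-- The polynomial symbols. -/
noncomputable def polyData : SymbolData (MvPolynomial Gen Qe) where
  t := MvPolynomial.X Gen.t
  a := MvPolynomial.X Gen.a
  x := MvPolynomial.X Gen.x
  shiftA := MvPolynomial.aeval fun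
    | Gen.a => MvPolynomial.X Gen.a - 1
    | g => MvPolynomial.X g
  shiftA_t := by simp
  shiftA_a := by simp
  shiftA_x := by simp

/-- With polynomial symbols and `y` sent to the variable `y`, the evaluation returns each
coefficient of `f` unchanged. -/
lemma ord_injective : Function.Injective ord := by
  intro f g hfg
  ext1 n
  have hs : polyData.symbols (MvPolynomial.X Gen.y) = MvPolynomial.X := by
    funext g
    cases g <;> rfl
  have h1 := eval_rep_ord polyData (MvPolynomial.X Gen.y) f n
  rw [hfg, eval_rep_ord, hs, MvPolynomial.aeval_X_left_apply, MvPolynomial.aeval_X_left_apply] at h1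
  exact h1.symm

end BandMap

namespace BandMap

open scoped TensorProduct Nat

/-! ### Reordering modulo `h`, for any family with relations of this type. -/

section Ordered

variable {C : Type*} [Ring C] [Algebra K C]

/-- The closed subalgebra generated by a family. -/
noncomputable def closedAdjoin (v : Gen → C) : Subalgebra K C :=
  hClosureAlg (Algebra.adjoin K (Set.range v))

lemma mem_closedAdjoin (v : Gen → C) (g : Gen) : v g ∈ closedAdjoin v :=
  le_hClosureAlg _ (Algebra.subset_adjoin ⟨g, rfl⟩)

/-- The commutation relations of `𝔻` up to multiples of `h`, where `[a, x] = δ x` and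
`[a, y] = -δ y`. -/
structure OrderRels (v : Gen → C) (δ : K) : Prop where
  t_comm : ∀ g, Commute (v Gen.t) (v g)
  a_x : v Gen.a * v Gen.x = v Gen.x * v Gen.a + δ • v Gen.x
  a_y : v Gen.a * v Gen.y = v Gen.y * v Gen.a - δ • v Gen.y
  x_y : ∃ w ∈ Algebra.adjoin K {v Gen.t, v Gen.a}, ∃ r ∈ closedAdjoin v,
    v Gen.x * v Gen.y = v Gen.y * v Gen.x + w + h • r

/-- The span of the products `yᵏ c xʳ`, where `c` is a polynomial in `t` and `a`. -/
noncomputable def orderedSpan (v : Gen → C) : Submodule K C :=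
  Submodule.span K {u | ∃ k r : ℕ, ∃ c ∈ Algebra.adjoin K {v Gen.t, v Gen.a},
    u = v Gen.y ^ k * c * v Gen.x ^ r}

/-- The elements that are in `orderedSpan v` up to `h` times an element of the closed subalgebra
generated by `v`. -/
noncomputable def nearOrdered (v : Gen → C) : Submodule K C :=
  orderedSpan v ⊔ (Subalgebra.toSubmodule (closedAdjoin v)).map (LinearMap.lsmul K C h)

lemma ordered_mem {v : Gen → C} (k r : ℕ) {c : C}
    (hc : c ∈ Algebra.adjoin K {v Gen.t, v Gen.a}) :
    v Gen.y ^ k * c * v Gen.x ^ r ∈ nearOrdered v :=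
  Submodule.mem_sup_left (Submodule.subset_span ⟨k, r, c, hc, rfl⟩)

lemma h_smul_mem_nearOrdered {v : Gen → C} {u : C} (hu : u ∈ closedAdjoin v) :
    h • u ∈ nearOrdered v :=
  Submodule.mem_sup_right ⟨u, hu, rfl⟩

lemma adjoin_ta_le (v : Gen → C) : Algebra.adjoin K {v Gen.t, v Gen.a} ≤ closedAdjoin v := by
  refine Algebra.adjoin_le ?_
  rintro u (rfl | rfl) <;> exact mem_closedAdjoin v _

variable {v : Gen → C} {δ : K}

/-- Moving `x` to the right past a polynomial in `t`, `a` substitutes `a - δ` for `a`. -/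
lemma OrderRels.x_mul (hv : OrderRels v δ) {c : C}
    (hc : c ∈ Algebra.adjoin K {v Gen.t, v Gen.a}) :
    ∃ c' ∈ Algebra.adjoin K {v Gen.t, v Gen.a}, v Gen.x * c = c' * v Gen.x := by
  induction hc using Algebra.adjoin_induction with
  | mem u hu =>
    rcases hu with rfl | rfl
    · exact ⟨_, Algebra.subset_adjoin (by simp), (hv.t_comm Gen.x).eq.symm⟩
    · refine ⟨v Gen.a - δ • 1, Subalgebra.sub_mem _ (Algebra.subset_adjoin (by simp))
        (Subalgebra.smul_mem _ (Subalgebra.one_mem _) _), ?_⟩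
      rw [sub_mul, hv.a_x, smul_mul_assoc, one_mul, add_sub_cancel_right]
  | algebraMap r => exact ⟨_, Subalgebra.algebraMap_mem _ r, (Algebra.commutes r _).symm⟩
  | add u w _ _ hu hw =>
    obtain ⟨u', hu', eu⟩ := hu
    obtain ⟨w', hw', ew⟩ := hw
    exact ⟨u' + w', Subalgebra.add_mem _ hu' hw', by rw [mul_add, eu, ew, add_mul]⟩
  | mul u w _ _ hu hw =>
    obtain ⟨u', hu', eu⟩ := hu
    obtain ⟨w', hw', ew⟩ := hw
    exact ⟨u' * w', Subalgebra.mul_mem _ hu' hw', by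
      rw [← mul_assoc, eu, mul_assoc, ew, mul_assoc]⟩

lemma OrderRels.mul_y (hv : OrderRels v δ) {c : C}
    (hc : c ∈ Algebra.adjoin K {v Gen.t, v Gen.a}) :
    ∃ c' ∈ Algebra.adjoin K {v Gen.t, v Gen.a}, c * v Gen.y = v Gen.y * c' := by
  induction hc using Algebra.adjoin_induction with
  | mem u hu =>
    rcases hu with rfl | rfl
    · exact ⟨_, Algebra.subset_adjoin (by simp), (hv.t_comm Gen.y).eq⟩
    · refine ⟨v Gen.a - δ • 1, Subalgebra.sub_mem _ (Algebra.subset_adjoin (by simp))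
        (Subalgebra.smul_mem _ (Subalgebra.one_mem _) _), ?_⟩
      rw [hv.a_y, mul_sub, mul_smul_comm, mul_one]
  | algebraMap r => exact ⟨_, Subalgebra.algebraMap_mem _ r, Algebra.commutes r _⟩
  | add u w _ _ hu hw =>
    obtain ⟨u', hu', eu⟩ := hu
    obtain ⟨w', hw', ew⟩ := hw
    exact ⟨u' + w', Subalgebra.add_mem _ hu' hw', by rw [add_mul, eu, ew, mul_add]⟩
  | mul u w _ _ hu hw =>
    obtain ⟨u', hu', eu⟩ := hu
    obtain ⟨w', hw', ew⟩ := hw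
    exact ⟨u' * w', Subalgebra.mul_mem _ hu' hw', by
      rw [mul_assoc, ew, ← mul_assoc, eu, mul_assoc]⟩

lemma OrderRels.mul_y_pow (hv : OrderRels v δ) (k : ℕ) {c : C}
    (hc : c ∈ Algebra.adjoin K {v Gen.t, v Gen.a}) :
    ∃ c' ∈ Algebra.adjoin K {v Gen.t, v Gen.a}, c * v Gen.y ^ k = v Gen.y ^ k * c' := by
  induction k with
  | zero => exact ⟨c, hc, by simp⟩
  | succ k ih =>
    obtain ⟨c', hc', e⟩ := ih
    obtain ⟨c'', hc'', e'⟩ := hv.mul_y hc'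
    exact ⟨c'', hc'', by rw [pow_succ, ← mul_assoc, e, mul_assoc, e', mul_assoc]⟩

/-- Each passage of `x` across a `y` leaves a polynomial in `t`, `a`, which is then moved behind the
remaining powers of `y`; all else is `h` times an element of the closed subalgebra. -/
lemma OrderRels.x_y_pow (hv : OrderRels v δ) (k : ℕ) :
    ∃ c ∈ Algebra.adjoin K {v Gen.t, v Gen.a}, ∃ r ∈ closedAdjoin v,
      v Gen.x * v Gen.y ^ (k + 1) = v Gen.y ^ (k + 1) * v Gen.x + v Gen.y ^ k * c + h • r := by
  obtain ⟨w, hw, r₀, hr₀, e₀⟩ := hv.x_y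
  have hy := mem_closedAdjoin v Gen.y
  induction k with
  | zero => exact ⟨w, hw, r₀, hr₀, by simpa using e₀⟩
  | succ k ih =>
    obtain ⟨c, hc, r, hr, e⟩ := ih
    obtain ⟨c', hc', e'⟩ := hv.mul_y hc
    refine ⟨w + c', Subalgebra.add_mem _ hw hc', v Gen.y ^ (k + 1) * r₀ + r * v Gen.y,
      add_mem (mul_mem (pow_mem hy _) hr₀) (mul_mem hr hy), ?_⟩
    rw [pow_succ _ (k + 1), ← mul_assoc, e, add_mul, add_mul, mul_assoc _ (v Gen.x), e₀,
      mul_assoc _ c, e', ← mul_assoc _ (v Gen.y) c', ← pow_succ]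
    simp only [mul_add, mul_smul_comm, smul_mul_assoc, smul_add, mul_assoc]
    abel

lemma OrderRels.mul_mem_nearOrdered (hv : OrderRels v δ) (g : Gen) {u : C}
    (hu : u ∈ nearOrdered v) : v g * u ∈ nearOrdered v := by
  suffices nearOrdered v ≤ (nearOrdered v).comap (LinearMap.mulLeft K (v g)) from this hu
  have hg : ∀ g, v g ∈ closedAdjoin v := mem_closedAdjoin v
  refine sup_le (Submodule.span_le.2 ?_) ?_
  · rintro _ ⟨k, r, c, hc, rfl⟩
    rw [SetLike.mem_coe, Submodule.mem_comap, LinearMap.mulLeft_apply]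
    -- The generators `t` and `a` are absorbed into the middle factor once they have passed `yᵏ`.
    have hta : v g ∈ Algebra.adjoin K {v Gen.t, v Gen.a} →
        v g * (v Gen.y ^ k * c * v Gen.x ^ r) ∈ nearOrdered v := fun h' => by
      obtain ⟨c', hc', e⟩ := hv.mul_y_pow k h'
      rw [← mul_assoc, ← mul_assoc, e, mul_assoc _ c']
      exact ordered_mem k r (mul_mem hc' hc)
    cases g with
    | y =>
      rw [← mul_assoc, ← mul_assoc, ← pow_succ']
      exact ordered_mem (k + 1) r hc
    | t => exact hta (Algebra.subset_adjoin (by simp))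
    | a => exact hta (Algebra.subset_adjoin (by simp))
    | x =>
      obtain ⟨c', hc', e⟩ := hv.x_mul hc
      cases k with
      | zero =>
        rw [pow_zero, one_mul, ← mul_assoc, e, mul_assoc, ← pow_succ']
        simpa using ordered_mem 0 (r + 1) hc'
      | succ k =>
        obtain ⟨c₁, hc₁, s, hs, e₁⟩ := hv.x_y_pow k
        have : v Gen.x * (v Gen.y ^ (k + 1) * c * v Gen.x ^ r)
            = v Gen.y ^ (k + 1) * c' * v Gen.x ^ (r + 1) +
              v Gen.y ^ k * (c₁ * c) * v Gen.x ^ r + h • (s * c * v Gen.x ^ r) := by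
          rw [← mul_assoc, ← mul_assoc, e₁, pow_succ' _ r]
          simp only [add_mul, mul_assoc, smul_mul_assoc]
          rw [← mul_assoc (v Gen.x) c, e, mul_assoc c']
        rw [this]
        exact add_mem (add_mem (ordered_mem _ _ hc') (ordered_mem _ _ (mul_mem hc₁ hc)))
          (h_smul_mem_nearOrdered (mul_mem (mul_mem hs (adjoin_ta_le v hc)) (pow_mem (hg _) _)))
  · rintro _ ⟨u, hu, rfl⟩
    rw [Submodule.mem_comap, LinearMap.mulLeft_apply, LinearMap.lsmul_apply, mul_smul_comm]
    exact h_smul_mem_nearOrdered (mul_mem (hg g) hu)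

/-- The error is `h` times an element of the closed subalgebra, not of all of `C`, so that it can
itself be reordered. -/
lemma OrderRels.adjoin_le (hv : OrderRels v δ) {u : C}
    (hu : u ∈ Algebra.adjoin K (Set.range v)) :
    ∃ s ∈ orderedSpan v, ∃ r ∈ closedAdjoin v, u = s + h • r := by
  -- Left multiplication by the generators preserves the nearly ordered elements, hence so does that
  -- by `u`; this is then applied to `1`.
  have key : ∀ m ∈ nearOrdered v, u * m ∈ nearOrdered v := by
    induction hu using Algebra.adjoin_induction with
    | mem u hu =>
      obtain ⟨g, rfl⟩ := hu
      exact fun m hm => hv.mul_mem_nearOrdered g hm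
    | algebraMap r =>
      intro m hm
      rw [← Algebra.smul_def]
      exact Submodule.smul_mem _ r hm
    | add u w _ _ hu hw =>
      intro m hm
      rw [add_mul]
      exact add_mem (hu m hm) (hw m hm)
    | mul u w _ _ hu hw =>
      intro m hm
      rw [mul_assoc]
      exact hu _ (hw m hm)
  have h1 : (1 : C) ∈ nearOrdered v := by
    simpa using ordered_mem (v := v) 0 0 (Subalgebra.one_mem _)
  have := key 1 h1
  rw [mul_one] at this
  obtain ⟨s, hs, _, ⟨r, hr, rfl⟩, e⟩ := Submodule.mem_sup.1 this
  exact ⟨s, hs, r, hr, e.symm⟩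

/-- As `t` and `a` commute, the polynomials in them are spanned by the products `tˡ aᵖ`. -/
lemma orderedSpan_le (hta : Commute (v Gen.t) (v Gen.a)) {N : Submodule K C}
    (H : ∀ k l p r : ℕ, v Gen.y ^ k * v Gen.t ^ l * v Gen.a ^ p * v Gen.x ^ r ∈ N) :
    orderedSpan v ≤ N := by
  have h1 : ∀ c ∈ Algebra.adjoin K {v Gen.t, v Gen.a},
      c ∈ Submodule.span K {c | ∃ l p : ℕ, c = v Gen.t ^ l * v Gen.a ^ p} := by
    intro c hc
    induction hc using Algebra.adjoin_induction with
    | mem u hu =>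
      rcases hu with rfl | rfl
      · exact Submodule.subset_span ⟨1, 0, by simp⟩
      · exact Submodule.subset_span ⟨0, 1, by simp⟩
    | algebraMap r =>
      rw [Algebra.algebraMap_eq_smul_one]
      exact Submodule.smul_mem _ _ (Submodule.subset_span ⟨0, 0, by simp⟩)
    | add u w _ _ hu hw => exact add_mem hu hw
    | mul u w _ _ hu hw =>
      refine Submodule.span_induction₂ (p := fun u w _ _ => u * w ∈ _) ?_ ?_ ?_ ?_ ?_ ?_ ?_ hu hw
      · rintro _ _ ⟨l, p, rfl⟩ ⟨l', p', rfl⟩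
        refine Submodule.subset_span ⟨l + l', p + p', ?_⟩
        rw [pow_add, pow_add, mul_assoc, ← mul_assoc (v Gen.a ^ p),
          ← (hta.pow_pow l' p).eq]
        simp only [mul_assoc]
      · intro _ _
        rw [zero_mul]
        exact zero_mem _
      · intro _ _
        rw [mul_zero]
        exact zero_mem _
      · intro _ _ _ _ _ _ h₁ h₂
        rw [add_mul]
        exact add_mem h₁ h₂
      · intro _ _ _ _ _ _ h₁ h₂
        rw [mul_add]
        exact add_mem h₁ h₂
      · intro r _ _ _ _ h₁
        rw [smul_mul_assoc]
        exact Submodule.smul_mem _ r h₁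
      · intro r _ _ _ _ h₁
        rw [mul_smul_comm]
        exact Submodule.smul_mem _ r h₁
  refine Submodule.span_le.2 ?_
  rintro _ ⟨k, r, c, hc, rfl⟩
  have : Submodule.span K {c | ∃ l p : ℕ, c = v Gen.t ^ l * v Gen.a ^ p} ≤ N.comap
      (LinearMap.mulRight K (v Gen.x ^ r) ∘ₗ LinearMap.mulLeft K (v Gen.y ^ k)) := by
    refine Submodule.span_le.2 ?_
    rintro _ ⟨l, p, rfl⟩
    simpa only [SetLike.mem_coe, Submodule.mem_comap, LinearMap.comp_apply, LinearMap.mulLeft_apply,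
      LinearMap.mulRight_apply, ← mul_assoc] using H k l p r
  exact this (h1 c hc)

/-- The closed subalgebra is contained in the closure of the span of the ordered monomials. -/
lemma OrderRels.closedAdjoin_le (hv : OrderRels v δ) {N : Submodule K C}
    (H : ∀ k l p r : ℕ, v Gen.y ^ k * v Gen.t ^ l * v Gen.a ^ p * v Gen.x ^ r ∈ N) {u : C}
    (hu : u ∈ closedAdjoin v) : u ∈ hClosure N := by
  intro n
  induction n generalizing u with
  | zero => exact ⟨0, zero_mem _, u, by simp⟩
  | succ n ih =>
    obtain ⟨u₀, hu₀, r₀, e₀⟩ := hu (n + 1)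
    obtain ⟨s, hs, r, hr, e⟩ := hv.adjoin_le hu₀
    -- The error `r` lies in the closed subalgebra, so the induction hypothesis approximates it to
    -- order `n`, and the factor `h` raises this to `n + 1`.
    obtain ⟨s', hs', r', e'⟩ := ih hr
    refine ⟨s + h • s', add_mem (orderedSpan_le (hv.t_comm _) H hs) (Submodule.smul_mem _ _ hs'),
      r' + r₀, ?_⟩
    rw [e₀, e, e', smul_add, smul_add, smul_smul, ← pow_succ']
    abel

end Ordered

/-! ### The families `y, t, a, x` and `y, t, εa, x`. -/

section Generators

lemma q_eq : q = 1 + h * shift q := by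
  conv_lhs => rw [eq_C_add_X_mul_shift q]
  rw [q, coeff_zero_expSeries, map_one]

/-- Both sources of `h` are expanded to first order: `q = 1 + O(h)` and `hQuot w = -w + O(h)`. -/
lemma order_x_y {C : Type*} [Ring C] [Algebra K C] [Algebra ℚ C] [IsAdicComplete hI C]
    {U : Subalgebra K C} {x y w : C} (hx : x ∈ hClosureAlg U)
    (hy : y ∈ hClosureAlg U) (hw : w ∈ hClosureAlg U) (H : x * y = q • (y * x) + hQuot w) :
    ∃ r ∈ hClosureAlg U, x * y = y * x + -w + h • r := by
  obtain ⟨r, hr, e⟩ := hQuot_eq hw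
  refine ⟨shift q • (y * x) + r, add_mem (Subalgebra.smul_mem _ (mul_mem hy hx) _) hr, ?_⟩
  rw [H, e]
  conv_lhs => rw [q_eq]
  rw [add_smul, one_smul, mul_smul, smul_add]
  abel

lemma orderRels_gD : OrderRels gD 1 where
  t_comm := relsD.t_comm
  a_x := by rw [one_smul, relsD.a_x]
  a_y := by rw [one_smul, relsD.a_y]
  x_y := by
    have ht : gD Gen.t ∈ Algebra.adjoin K {gD Gen.t, gD Gen.a} :=
      Algebra.subset_adjoin (by simp)
    have ha : gD Gen.a ∈ Algebra.adjoin K {gD Gen.t, gD Gen.a} :=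
      Algebra.subset_adjoin (by simp)
    have hw : -wexp (gD Gen.t) (gD Gen.a) ∈ Algebra.adjoin K {gD Gen.t, gD Gen.a} := by
      rw [wexp, neg_neg]
      exact add_mem (Subalgebra.smul_mem _ (add_mem ha ha) _) ht
    refine ⟨_, hw, order_x_y (mem_closedAdjoin gD _) (mem_closedAdjoin gD _) ?_ relsD.x_y⟩
    rw [← neg_neg (wexp _ _)]
    exact neg_mem (adjoin_ta_le gD hw)

/-- The elements `y`, `t`, `εa`, `x`. -/
noncomputable def redGen : Gen → D
  | Gen.a => eps • gD Gen.a
  | g => gD g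

/-- The closed subalgebra of `𝔻` generated by `y`, `t`, `εa`, `x`. -/
noncomputable def redD : Subalgebra K D := closedAdjoin redGen

lemma redGen_mem (g : Gen) : redGen g ∈ redD := mem_closedAdjoin redGen g

/-- The point is that the exponent `-(2εa + t)` contains `a` only through `εa`; the commutators of
`εa` with `x` and `y` get the factor `ε`. -/
lemma orderRels_redGen : OrderRels redGen eps where
  t_comm g := by
    cases g with
    | a => exact (relsD.t_comm Gen.a).smul_right eps
    | y => exact relsD.t_comm Gen.y
    | t => exact relsD.t_comm Gen.t
    | x => exact relsD.t_comm Gen.x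
  a_x := by
    simp only [redGen]
    rw [smul_mul_assoc, relsD.a_x, smul_add, mul_smul_comm]
  a_y := by
    simp only [redGen]
    rw [smul_mul_assoc, relsD.a_y, smul_sub, mul_smul_comm]
  x_y := by
    have ht : redGen Gen.t ∈ Algebra.adjoin K {redGen Gen.t, redGen Gen.a} :=
      Algebra.subset_adjoin (by simp)
    have ha : redGen Gen.a ∈ Algebra.adjoin K {redGen Gen.t, redGen Gen.a} :=
      Algebra.subset_adjoin (by simp)
    have hw : -wexp (gD Gen.t) (gD Gen.a) ∈ Algebra.adjoin K {redGen Gen.t, redGen Gen.a} := by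
      rw [wexp, neg_neg, smul_add]
      exact add_mem (add_mem ha ha) ht
    refine ⟨_, hw, order_x_y (mem_closedAdjoin redGen Gen.x)
      (mem_closedAdjoin redGen Gen.y) ?_ relsD.x_y⟩
    rw [← neg_neg (wexp _ _)]
    exact neg_mem (adjoin_ta_le redGen hw)

/-- Successive approximation: the remainder after division by `h` is again an arbitrary element of
`M`. -/
lemma mem_hClosure_of_mod_h {M : Type*} [AddCommGroup M] [Module K M] {N : Submodule K M}
    (H : ∀ m : M, ∃ s ∈ N, ∃ r : M, m = s + h • r) (m : M) : m ∈ hClosure N := by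
  intro n
  induction n generalizing m with
  | zero => exact ⟨0, zero_mem _, m, by simp⟩
  | succ n ih =>
    obtain ⟨s, hs, r, rfl⟩ := H m
    obtain ⟨s', hs', r', rfl⟩ := ih r
    exact ⟨s + h • s', add_mem hs (Submodule.smul_mem _ _ hs'), r', by
      rw [smul_add, smul_smul, ← pow_succ', add_assoc]⟩

/-- Modulo `h` an element of `𝔻` is the value of a noncommutative polynomial, namely the constant
coefficient of a lift to the free algebra. -/
lemma mem_closedAdjoin_gD (u : D) : u ∈ closedAdjoin gD := by
  refine mem_hClosure_of_mod_h (fun u => ?_) u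
  obtain ⟨f, rfl⟩ := toD_surjective u
  have hC : ∀ p : Free, evalFree gD p ∈ Algebra.adjoin K (Set.range gD) := fun p => by
    induction p using FreeAlgebra.induction with
    | grade0 r =>
      rw [evalFree_algebraMap]
      exact Subalgebra.algebraMap_mem _ _
    | grade1 g =>
      rw [evalFree_ι]
      exact Algebra.subset_adjoin ⟨g, rfl⟩
    | mul a b ha hb =>
      rw [map_mul]
      exact mul_mem ha hb
    | add a b ha hb =>
      rw [map_add]
      exact add_mem ha hb
  refine ⟨_, hC (PowerSeries.coeff 0 f), toD (shift f), ?_⟩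
  conv_lhs => rw [eq_C_add_X_mul_shift f]
  rw [map_add, toD_C, ← map_smul]
  congr 2
  have := h_pow_smul_freeH 1 (shift f)
  rw [pow_one, pow_one] at this
  exact this.symm

end Generators

/-! ### Surjectivity of `ord` and the exponents that occur in `redD`. -/

section Ordering

lemma ord_add (f g : PowerSeries (MvPolynomial Gen Qe)) : ord (f + g) = ord f + ord g := by
  rw [ord, ord, ord, ← map_add]
  congr 1
  ext1 n
  simp only [map_add, PowerSeries.coeff_mk]

lemma ord_smul (r : K) (f : PowerSeries (MvPolynomial Gen Qe)) :
    ord (PowerSeries.map MvPolynomial.C r * f) = r • ord f := by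
  rw [ord, ord, ← map_smul, Algebra.smul_def, algebraMap_freeH]
  congr 1
  ext1 n
  simp only [PowerSeries.coeff_mul, PowerSeries.coeff_mk, map_sum, PowerSeries.coeff_map,
    ← Algebra.smul_def, ← MvPolynomial.smul_eq_C_mul, map_smul]

lemma ord_zero : ord 0 = 0 := by
  have := ord_add 0 0
  rwa [add_zero, left_eq_add] at this

lemma ord_X_pow_mul (n : ℕ) (f : PowerSeries (MvPolynomial Gen Qe)) :
    ord (PowerSeries.X ^ n * f) = h ^ n • ord f := by
  rw [← ord_smul, map_pow, PowerSeries.map_X]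

/-- The exponents `(k, l, p, r)` of `yᵏ tˡ aᵖ xʳ`. -/
noncomputable def exponents (k l p r : ℕ) : Gen →₀ ℕ :=
  Finsupp.single Gen.y k + Finsupp.single Gen.t l + Finsupp.single Gen.a p + Finsupp.single Gen.x r

lemma exponents_a (k l p r : ℕ) : exponents k l p r Gen.a = p := by simp [exponents]

lemma ord_exponents (k l p r : ℕ) (c : Qe) :
    ord (PowerSeries.C (MvPolynomial.monomial (exponents k l p r) c))
      = PowerSeries.C c • (gD Gen.y ^ k * gD Gen.t ^ l * gD Gen.a ^ p * gD Gen.x ^ r) := by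
  have := ord_monomial (exponents k l p r) c 0
  rw [PowerSeries.monomial_zero_eq_C_apply, pow_zero, one_mul] at this
  rw [this]
  simp [exponents]

/-- The reordering is used only to first order. Repeated division of the remainder by `h` then
produces all coefficients of a preimage, and `𝔻` is `h`-adically separated. -/
lemma ord_surjective : Function.Surjective ord := by
  let N : Submodule K D :=
    { carrier := Set.range ord
      zero_mem' := ⟨0, ord_zero⟩
      add_mem' := by
        rintro _ _ ⟨f, rfl⟩ ⟨g, rfl⟩
        exact ⟨f + g, ord_add f g⟩
      smul_mem' := by
        rintro r _ ⟨f, rfl⟩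
        exact ⟨_, ord_smul r f⟩ }
  have H : ∀ u : D, ∃ p : MvPolynomial Gen Qe, ∃ r : D, u = ord (PowerSeries.C p) + h • r := by
    intro u
    obtain ⟨_, ⟨f, rfl⟩, r, e⟩ := orderRels_gD.closedAdjoin_le (N := N) (fun k l p r =>
      ⟨_, by simpa using ord_exponents k l p r 1⟩) (mem_closedAdjoin_gD u) 1
    refine ⟨PowerSeries.coeff 0 f, ord (shift f) + r, ?_⟩
    rw [e, smul_add, ← add_assoc, pow_one]
    congr 1
    have := ord_X_pow_mul 1 (shift f)
    rw [pow_one, pow_one] at this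
    rw [← this, ← ord_add, ← eq_C_add_X_mul_shift]
  choose P ρ hP using H
  intro u
  -- Here `u = P(u) + h ρ(u)`, so the coefficient of `hⁱ` is `P` of the `i`-th iterated remainder.
  refine ⟨PowerSeries.mk fun i => P (ρ^[i] u), eq_of_forall_h fun n => ?_⟩
  induction n generalizing u with
  | zero => exact ⟨_, by rw [pow_zero, one_smul]⟩
  | succ n ih =>
    obtain ⟨r, hr⟩ := ih (ρ u)
    refine ⟨r, ?_⟩
    rw [pow_succ', mul_smul, ← hr, smul_sub]
    have := ord_X_pow_mul 1 (shift (PowerSeries.mk fun i => P (ρ^[i] u)))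
    rw [pow_one, pow_one] at this
    have e : shift (PowerSeries.mk fun i => P (ρ^[i] u))
        = PowerSeries.mk fun i => P (ρ^[i] (ρ u)) := by
      ext1 i
      simp [shift]
    conv_lhs => rw [eq_C_add_X_mul_shift (PowerSeries.mk _)]
    rw [ord_add, this, PowerSeries.coeff_mk, e, Function.iterate_zero, id_eq]
    nth_rw 3 [hP u]
    abel

/-- As a divisibility by `εᵖ`, the condition is visibly stable under sums and under scalars from
`ℚ[ε][[h]]`. -/
lemma star_iff (f : PowerSeries (MvPolynomial Gen Qe)) : Star f ↔ ∀ (m : Gen →₀ ℕ) (n : ℕ),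
    (Polynomial.X : Qe) ^ m Gen.a ∣ (PowerSeries.coeff n f).coeff m := by
  simp only [Polynomial.X_pow_dvd_iff, Star, monCoeff]
  constructor
  · intro H m n j hj
    by_contra h'
    exact absurd (H m j n h') (by omega)
  · intro H m j n h'
    by_contra hj
    exact h' (H m n j (by omega))

/-- The elements whose monomials satisfy the condition of `Star`. -/
noncomputable def starRange : Submodule K D where
  carrier := {u | ∃ f, Star f ∧ ord f = u}
  zero_mem' := ⟨0, by simp [star_iff], ord_zero⟩
  add_mem' := by
    rintro _ _ ⟨f, hf, rfl⟩ ⟨g, hg, rfl⟩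
    refine ⟨f + g, ?_, ord_add f g⟩
    rw [star_iff] at *
    intro m n
    rw [map_add, MvPolynomial.coeff_add]
    exact dvd_add (hf m n) (hg m n)
  smul_mem' := by
    rintro r _ ⟨f, hf, rfl⟩
    refine ⟨_, ?_, ord_smul r f⟩
    rw [star_iff] at *
    intro m n
    rw [PowerSeries.coeff_mul, MvPolynomial.coeff_sum]
    refine Finset.dvd_sum fun p _ => ?_
    rw [PowerSeries.coeff_map, MvPolynomial.coeff_C_mul]
    exact Dvd.dvd.mul_left (hf m _) _

/-- The monomials in `redGen` contain `(εa)ᵖ = εᵖ aᵖ`, and elements of `redD` are limits of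
combinations of them. Injectivity of `ord` carries this to the coefficients of `f`. -/
lemma star_of_mem_redD {f : PowerSeries (MvPolynomial Gen Qe)} (hf : ord f ∈ redD) : Star f := by
  classical
  have H : ∀ k l p r : ℕ, redGen Gen.y ^ k * redGen Gen.t ^ l * redGen Gen.a ^ p *
      redGen Gen.x ^ r ∈ starRange := by
    intro k l p r
    refine ⟨PowerSeries.C (MvPolynomial.monomial (exponents k l p r) (Polynomial.X ^ p)), ?_, ?_⟩
    · rw [star_iff]
      intro m n
      rw [PowerSeries.coeff_C]
      split_ifs
      · rw [MvPolynomial.coeff_monomial]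
        split_ifs with h'
        · rw [← h', exponents_a]
        · exact dvd_zero _
      · exact dvd_zero _
    · rw [ord_exponents]
      simp only [redGen, smul_pow, mul_smul_comm, smul_mul_assoc, map_pow]
  rw [star_iff]
  intro m n
  -- An approximation modulo `hⁿ⁺¹` has the same coefficient at `hⁿ` as `f`.
  obtain ⟨_, ⟨g, hg, rfl⟩, r, e⟩ := orderRels_redGen.closedAdjoin_le H hf (n + 1)
  obtain ⟨r, rfl⟩ := ord_surjective r
  rw [← ord_X_pow_mul, ← ord_add] at e
  rw [ord_injective e, map_add, PowerSeries.coeff_X_pow_mul', if_neg (by omega), add_zero]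
  exact (star_iff g).1 hg m n

/-- The monomials with a power of `a` larger than the power of `ε` do not occur in the subalgebra
`redD`. -/
lemma eq_zero_of_mem_badSpan {n j : ℕ} (hj : 1 ≤ j) {w : D} (hw : w ∈ badSpan n j)
    (hred : w ∈ redD) : w = 0 := by
  classical
  -- Scalars in `ℚ[[h]]` involve neither `ε` nor the generators, so the span keeps the exponents `n
  -- + j` of `a` and `n` of `ε`. With `j ≥ 1` this contradicts the bound valid in `redD`.
  let N : Submodule Qh D :=
    { carrier := {u | ∃ f, (∀ m i l, monCoeff f m i l ≠ 0 → m Gen.a = n + j ∧ i = n) ∧ ord f = u}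
      zero_mem' := ⟨0, by simp [monCoeff], ord_zero⟩
      add_mem' := by
        rintro _ _ ⟨f, hf, rfl⟩ ⟨g, hg, rfl⟩
        refine ⟨f + g, fun m i l h' => ?_, ord_add f g⟩
        by_contra hne
        have h₁ : monCoeff f m i l = 0 := by
          by_contra h''
          exact hne (hf m i l h'')
        have h₂ : monCoeff g m i l = 0 := by
          by_contra h''
          exact hne (hg m i l h'')
        refine h' ?_
        simp only [monCoeff, map_add, MvPolynomial.coeff_add, Polynomial.coeff_add] at *
        rw [h₁, h₂, add_zero]
      smul_mem' := by
        rintro ⟨_, r, rfl⟩ _ ⟨f, hf, rfl⟩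
        refine ⟨_, fun m i l h' => ?_, ord_smul _ f⟩
        by_contra hne
        refine h' ?_
        simp only [monCoeff]
        rw [PowerSeries.coeff_mul, MvPolynomial.coeff_sum, Polynomial.finsetSum_coeff]
        refine Finset.sum_eq_zero fun p _ => ?_
        rw [PowerSeries.coeff_map, PowerSeries.coeff_map, MvPolynomial.coeff_C_mul,
          Polynomial.coeff_C_mul]
        have : monCoeff f m i p.2 = 0 := by
          by_contra h''
          exact hne (hf m i _ h'')
        rw [monCoeff] at this
        rw [this, mul_zero] }
  have hN : badSpan n j ≤ N := by
    refine Submodule.span_le.2 ?_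
    rintro _ ⟨k, l, r, rfl⟩
    refine ⟨PowerSeries.C (MvPolynomial.monomial (exponents k l (n + j) r) (Polynomial.X ^ n)),
      fun m i l' h' => ?_, ?_⟩
    · rw [monCoeff, PowerSeries.coeff_C] at h'
      split_ifs at h'
      · rw [MvPolynomial.coeff_monomial] at h'
        split_ifs at h' with hm
        · rw [Polynomial.coeff_X_pow] at h'
          split_ifs at h' with hi
          · exact ⟨by rw [← hm, exponents_a], hi⟩
          · exact absurd rfl h'
        · exact absurd (by simp) h'
      · exact absurd (by simp) h'
    · rw [ord_exponents, map_pow]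
  obtain ⟨f, hf, rfl⟩ := hN hw
  have hs := star_of_mem_redD hred
  have : f = 0 := by
    ext l m i
    by_contra h'
    have h₁ := hs m i l h'
    have h₂ := hf m i l h'
    omega
  rw [this, ord_zero]

end Ordering

end BandMap

namespace BandMap

open scoped TensorProduct Nat

/-! ### Stability of `redD` under the structure maps of `𝔻`. -/

section Reduced

lemma AD_mem_redD : AD ∈ redD := hExp_mem (neg_mem (redGen_mem Gen.a))

lemma AinvD_mem_redD : AinvD ∈ redD := hExp_mem (redGen_mem Gen.a)

lemma TD_mem_redD : TD ∈ redD := hExp_mem (neg_mem (redGen_mem Gen.t))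

lemma TinvD_mem_redD : TinvD ∈ redD := hExp_mem (redGen_mem Gen.t)

lemma kappa_mem_redD : kappa ∈ redD :=
  hExp_mem (sub_mem (neg_mem (redGen_mem Gen.a)) (rat_smul_mem (redGen_mem Gen.t) _))

/-- A linear map sends `redD` into a closed submodule if it does so on the generated subalgebra. -/
lemma map_mem_of_mem_redD {P : Type*} [AddCommGroup P] [Module K P] (L : D →ₗ[K] P)
    {N : Submodule K P} (H : ∀ u ∈ Algebra.adjoin K (Set.range redGen), L u ∈ hClosure N) {u : D}
    (hu : u ∈ redD) : L u ∈ hClosure N :=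
  map_mem_hClosure L H hu

lemma adjoin_redGen_le : Algebra.adjoin K (Set.range redGen) ≤ redD := le_hClosureAlg _

/-- The commutator with `a` is a derivation which sends `y`, `t`, `εa`, `x` to `-y`, `0`, `0`, `x`.
-/
lemma commutator_a_mem_redD {u : D} (hu : u ∈ redD) : gD Gen.a * u - u * gD Gen.a ∈ redD := by
  refine map_mem_of_mem_redD (LinearMap.mulLeft K (gD Gen.a) - LinearMap.mulRight K (gD Gen.a))
    (fun u hu => ?_) hu
  rw [LinearMap.sub_apply, LinearMap.mulLeft_apply, LinearMap.mulRight_apply]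
  -- By definition `redD` is the `hClosure` of the generated subalgebra, so the goal is membership
  -- in an algebra and products are available.
  change _ ∈ redD
  induction hu using Algebra.adjoin_induction with
  | mem u hu =>
    obtain ⟨g, rfl⟩ := hu
    cases g with
    | y =>
      simp only [redGen]
      rw [relsD.a_y, sub_sub_cancel_left]
      exact neg_mem (redGen_mem Gen.y)
    | t =>
      simp only [redGen]
      rw [(relsD.t_comm Gen.a).eq, sub_self]
      exact zero_mem _
    | a =>
      simp only [redGen]
      rw [mul_smul_comm, smul_mul_assoc, sub_self]
      exact zero_mem _
    | x =>
      simp only [redGen]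
      rw [relsD.a_x, add_sub_cancel_left]
      exact redGen_mem Gen.x
  | algebraMap r =>
    rw [Algebra.commutes, sub_self]
    exact zero_mem _
  | add u w _ _ hu hw =>
    rw [mul_add, add_mul, add_sub_add_comm]
    exact add_mem hu hw
  | mul u w hu' hw' hu hw =>
    have : gD Gen.a * (u * w) - u * w * gD Gen.a
        = (gD Gen.a * u - u * gD Gen.a) * w + u * (gD Gen.a * w - w * gD Gen.a) := by
      noncomm_ring
    rw [this]
    exact add_mem (mul_mem hu (adjoin_redGen_le hw')) (mul_mem (adjoin_redGen_le hu') hw)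

lemma antipode_one : antipode 1 = 1 := by
  change MulOpposite.unop (antipodeOp 1) = 1
  rw [map_one, MulOpposite.unop_one]

lemma antipode_mem_redD {u : D} (hu : u ∈ redD) : antipode u ∈ redD := by
  refine map_mem_of_mem_redD antipode (fun u hu => ?_) hu
  change _ ∈ redD
  induction hu using Algebra.adjoin_induction with
  | mem u hu =>
    obtain ⟨g, rfl⟩ := hu
    cases g with
    | y =>
      simp only [redGen, antipode_gD, antipodeGen]
      exact neg_mem (mul_mem (redGen_mem Gen.y) (mul_mem AinvD_mem_redD TinvD_mem_redD))
    | t =>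
      simp only [redGen, antipode_gD, antipodeGen]
      exact neg_mem (redGen_mem Gen.t)
    | a =>
      simp only [redGen, map_smul, antipode_gD, antipodeGen, smul_neg]
      exact neg_mem (redGen_mem Gen.a)
    | x =>
      simp only [redGen, antipode_gD, antipodeGen]
      exact neg_mem (mul_mem (redGen_mem Gen.x) AinvD_mem_redD)
  | algebraMap r =>
    rw [Algebra.algebraMap_eq_smul_one, map_smul, antipode_one]
    exact Subalgebra.smul_mem _ (one_mem _) r
  | add u w _ _ hu hw =>
    rw [map_add]
    exact add_mem hu hw
  | mul u w _ _ hu hw =>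
    rw [antipode_mul]
    exact mul_mem hw hu

/-- The closed subalgebra of `𝔻 ⊗̂ 𝔻` generated by `u ⊗ w` with `u` and `w` in `redD`. -/
noncomputable def redDD : Subalgebra K DD :=
  hClosureAlg (toDD.comp (Algebra.TensorProduct.map redD.val redD.val)).range

lemma tmul_mem_redDD {u w : D} (hu : u ∈ redD) (hw : w ∈ redD) : toDD (u ⊗ₜ[K] w) ∈ redDD :=
  le_hClosureAlg _ ⟨(⟨u, hu⟩ : redD) ⊗ₜ[K] (⟨w, hw⟩ : redD), rfl⟩

lemma map_mem_of_mem_redDD {P : Type*} [AddCommGroup P] [Module K P] (L : DD →ₗ[K] P)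
    {N : Submodule K P} (H : ∀ u ∈ redD, ∀ w ∈ redD, L (toDD (u ⊗ₜ[K] w)) ∈ hClosure N) {X : DD}
    (hX : X ∈ redDD) : L X ∈ hClosure N := by
  refine map_mem_hClosure L ?_ hX
  rintro _ ⟨z, rfl⟩
  induction z using TensorProduct.induction_on with
  | zero =>
    rw [map_zero, map_zero]
    exact zero_mem _
  | tmul u w => exact H u u.2 w w.2
  | add z z' hz hz' =>
    rw [map_add, map_add]
    exact add_mem hz hz'

/-- It suffices to look at the generators. There `ε` may be moved into either tensor factor of
`Δ(a)`, and `T`, `A` lie in `redD`. -/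
lemma comul_mem_redDD {u : D} (hu : u ∈ redD) : comul u ∈ redDD := by
  refine map_mem_of_mem_redD comul.toLinearMap (fun u hu => ?_) hu
  have h1 : (1 : D) ∈ redD := one_mem _
  suffices Algebra.adjoin K (Set.range redGen) ≤ redDD.comap comul from this hu
  refine Algebra.adjoin_le ?_
  rintro _ ⟨g, rfl⟩
  change comul (redGen g) ∈ redDD
  cases g with
  | y =>
    simp only [redGen, comul_gD, comulGen, map_add]
    exact add_mem (tmul_mem_redDD h1 (redGen_mem Gen.y))
      (tmul_mem_redDD (redGen_mem Gen.y) (mul_mem TD_mem_redD AD_mem_redD))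
  | t =>
    simp only [redGen, comul_gD, comulGen, map_add]
    exact add_mem (tmul_mem_redDD (redGen_mem Gen.t) h1) (tmul_mem_redDD h1 (redGen_mem Gen.t))
  | a =>
    simp only [redGen, map_smul, comul_gD, comulGen]
    rw [← map_smul, smul_add, TensorProduct.smul_tmul', ← TensorProduct.tmul_smul, map_add]
    exact add_mem (tmul_mem_redDD (redGen_mem Gen.a) h1) (tmul_mem_redDD h1 (redGen_mem Gen.a))
  | x =>
    simp only [redGen, comul_gD, comulGen, map_add]
    exact add_mem (tmul_mem_redDD h1 (redGen_mem Gen.x))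
      (tmul_mem_redDD (redGen_mem Gen.x) AD_mem_redD)

lemma commutator_inl_a_mem_redDD {X : DD} (hX : X ∈ redDD) :
    inl (gD Gen.a) * X - X * inl (gD Gen.a) ∈ redDD := by
  refine map_mem_of_mem_redDD
    (LinearMap.mulLeft K (inl (gD Gen.a)) - LinearMap.mulRight K (inl (gD Gen.a)))
    (fun u hu w hw => ?_) hX
  have : inl (gD Gen.a) = toDD (gD Gen.a ⊗ₜ[K] 1) := rfl
  rw [LinearMap.sub_apply, LinearMap.mulLeft_apply, LinearMap.mulRight_apply, this, ← map_mul,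
    ← map_mul, ← map_sub, Algebra.TensorProduct.tmul_mul_tmul, Algebra.TensorProduct.tmul_mul_tmul,
    one_mul, mul_one, ← TensorProduct.sub_tmul]
  exact tmul_mem_redDD (commutator_a_mem_redD hu) hw

end Reduced

/-! ### The images of `B` and `Th`. -/

section Band

lemma bilinear_mem_of_mem_redDD (f : DD →ₗ[K] DD →ₗ[K] D)
    (H : ∀ u ∈ redD, ∀ w ∈ redD, ∀ u' ∈ redD, ∀ w' ∈ redD,
      f (toDD (u ⊗ₜ[K] w)) (toDD (u' ⊗ₜ[K] w')) ∈ redD) {X Y : DD} (hX : X ∈ redDD)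
    (hY : Y ∈ redDD) : f X Y ∈ redD :=
  map_mem_of_mem_redDD (f.flip Y) (fun u hu w hw =>
    map_mem_of_mem_redDD (f (toDD (u ⊗ₜ[K] w))) (fun u' hu' w' hw' => H u hu w hw u' hu' w' hw')
      hY) hX

lemma sandwich_mem_redD {X Y : DD} (hX : X ∈ redDD) (hY : Y ∈ redDD) :
    extendDD₂ sandwich X Y ∈ redD := by
  refine bilinear_mem_of_mem_redDD (extendDD₂ sandwich) (fun u hu w hw u' hu' w' hw' => ?_) hX hY
  rw [extendDD₂_toDD, sandwich_tmul]
  exact mul_mem (mul_mem (mul_mem (mul_mem (mul_mem hw (antipode_mem_redD hu')) kappa_mem_redD)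
    (antipode_mem_redD hu)) kappa_mem_redD) hw'

/-- Sums of pure tensors are dense in `𝔻 ⊗̂ 𝔻`, so identities of bilinear maps may be checked on
pure tensors. -/
lemma eq_of_eq_toDD_tmul {f g : DD →ₗ[K] DD →ₗ[K] D}
    (H : ∀ u w u' w' : D, f (toDD (u ⊗ₜ[K] w)) (toDD (u' ⊗ₜ[K] w'))
      = g (toDD (u ⊗ₜ[K] w)) (toDD (u' ⊗ₜ[K] w'))) (X Y : DD) : f X Y = g X Y := by
  have h1 : ∀ z z' : D ⊗[K] D, f (toDD z) (toDD z') = g (toDD z) (toDD z') := by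
    intro z z'
    induction z using TensorProduct.induction_on with
    | zero => simp only [map_zero, LinearMap.zero_apply]
    | add z₁ z₂ h₁ h₂ => simp only [map_add, LinearMap.add_apply, h₁, h₂]
    | tmul u w =>
      induction z' using TensorProduct.induction_on with
      | zero => simp only [map_zero]
      | add z₁ z₂ h₁ h₂ => simp only [map_add, h₁, h₂]
      | tmul u' w' => exact H u w u' w'
  exact eq_of_eq_of₂ (M := D ⊗[K] D) (N := D ⊗[K] D) (f := f) (g := g) h1 X Y

lemma a_comm_kappa : gD Gen.a * kappa = kappa * gD Gen.a :=
  hExp_comm ((((Commute.refl _).smul_right eps).neg_right).sub_right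
    ((relsD.t_comm Gen.a).symm.smul_right (1 / 2 : ℚ)))

lemma antipode_a_mul (u : D) : antipode (gD Gen.a * u) = -(antipode u * gD Gen.a) := by
  rw [antipode_mul, antipode_gD, antipodeGen, mul_neg]

lemma antipode_mul_a (u : D) : antipode (u * gD Gen.a) = -(gD Gen.a * antipode u) := by
  rw [antipode_mul, antipode_gD, antipodeGen, neg_mul]

lemma inl_a : inl (gD Gen.a) = toDD (gD Gen.a ⊗ₜ[K] 1) := rfl

/-- The summand `1 ⊗ a` puts `a` to the left of `S(y₁)`; the summand `a ⊗ 1` puts `-a` to the left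
of `S(x₁)`, and `κ` lets it move to the right end of `S(y₁)`. The sum is `[a, S(y₁)] = S([a, y₁])`.
-/
lemma sandwich_mul_comul_a (X Y : DD) : extendDD₂ sandwich (X * comul (gD Gen.a)) Y
    = extendDD₂ sandwich X (inl (gD Gen.a) * Y - Y * inl (gD Gen.a)) := by
  refine eq_of_eq_toDD_tmul (f := extendDD₂ sandwich ∘ₗ LinearMap.mulRight K (comul (gD Gen.a)))
    (g := (extendDD₂ sandwich).compl₂ (LinearMap.mulLeft K (inl (gD Gen.a)) -
      LinearMap.mulRight K (inl (gD Gen.a)))) (fun u w u' w' => ?_) X Y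
  simp only [LinearMap.comp_apply, LinearMap.compl₂_apply, LinearMap.sub_apply,
    LinearMap.mulLeft_apply, LinearMap.mulRight_apply, comul_gD, comulGen, inl_a, ← map_mul,
    mul_add, Algebra.TensorProduct.tmul_mul_tmul, mul_one, one_mul, map_sub, map_add,
    LinearMap.add_apply, extendDD₂_toDD, sandwich_tmul, antipode_a_mul, antipode_mul_a]
  have h1 : w * antipode u' * kappa * (-(gD Gen.a * antipode u))
      = -(w * antipode u' * gD Gen.a * kappa * antipode u) := by
    rw [mul_neg, ← mul_assoc, mul_assoc _ kappa, ← a_comm_kappa]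
    simp only [mul_assoc]
  rw [h1]
  noncomm_ring

/-- The mirror image: `-a` from `S(a y₁)` and `a` from `a y₂` both move through a `κ` to the two
sides of `S(x₁)`, which gives `-[a, S(x₁)] = -S([a, x₁])`. -/
lemma sandwich_comul_a_mul (X Y : DD) : extendDD₂ sandwich X (comul (gD Gen.a) * Y)
    = -extendDD₂ sandwich (inl (gD Gen.a) * X - X * inl (gD Gen.a)) Y := by
  refine eq_of_eq_toDD_tmul
    (f := (extendDD₂ sandwich).compl₂ (LinearMap.mulLeft K (comul (gD Gen.a))))
    (g := -(extendDD₂ sandwich ∘ₗ (LinearMap.mulLeft K (inl (gD Gen.a)) -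
      LinearMap.mulRight K (inl (gD Gen.a))))) (fun u w u' w' => ?_) X Y
  simp only [LinearMap.comp_apply, LinearMap.compl₂_apply, LinearMap.sub_apply,
    LinearMap.mulLeft_apply, LinearMap.mulRight_apply, comul_gD, comulGen, inl_a, ← map_mul,
    add_mul, Algebra.TensorProduct.tmul_mul_tmul, mul_one, one_mul, map_sub, map_add,
    LinearMap.neg_apply, extendDD₂_toDD, sandwich_tmul, antipode_a_mul, antipode_mul_a]
  have h1 : w * -(antipode u' * gD Gen.a) * kappa = -(w * antipode u' * kappa * gD Gen.a) := by
    rw [mul_neg, neg_mul, ← mul_assoc, mul_assoc _ (gD Gen.a), a_comm_kappa, ← mul_assoc]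
  have h2 : w * antipode u' * kappa * antipode u * kappa * (gD Gen.a * w')
      = w * antipode u' * kappa * (antipode u * gD Gen.a) * kappa * w' := by
    rw [← mul_assoc, mul_assoc _ kappa, ← a_comm_kappa]
    simp only [mul_assoc]
  rw [h1, h2]
  noncomm_ring

lemma inl_a_comm_comul_a : Commute (inl (gD Gen.a)) (comul (gD Gen.a)) := by
  have : comul (gD Gen.a) = inl (gD Gen.a) + inr (gD Gen.a) := by
    rw [comul_gD, comulGen, map_add]
    rfl
  rw [this]
  exact (Commute.refl _).add_right (inl_comm_inr _ _)

/-- Each factor `Δ(a)` is traded for a commutator with `a ⊗ 1` in the other argument, and these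
commutators keep `X` and `Y` in `redDD`. -/
lemma sandwich_comul_a_pow_mem (p s : ℕ) {X Y : DD} (hX : X ∈ redDD) (hY : Y ∈ redDD) :
    extendDD₂ sandwich (X * comul (gD Gen.a) ^ p) (comul (gD Gen.a) ^ s * Y) ∈ redD := by
  induction p generalizing X Y with
  | zero =>
    rw [pow_zero, mul_one]
    induction s generalizing X with
    | zero =>
      rw [pow_zero, one_mul]
      exact sandwich_mem_redD hX hY
    | succ s ih =>
      rw [pow_succ', mul_assoc, sandwich_comul_a_mul]
      exact neg_mem (ih (commutator_inl_a_mem_redDD hX))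
  | succ p ih =>
    -- As `a ⊗ 1` commutes with `Δ(a)`, the commutator passes the factor `Δ(a)ˢ` and falls on `Y`
    -- alone.
    rw [pow_succ, ← mul_assoc, sandwich_mul_comul_a, ← mul_assoc,
      (inl_a_comm_comul_a.pow_right s).eq, mul_assoc, mul_assoc, ← mul_sub]
    exact ih hX (commutator_inl_a_mem_redDD hY)

/-- Of the four generators only `a` is not one of the generators of `redD`. -/
lemma gD_cases {p : D → Prop} (ha : p (gD Gen.a)) (hr : ∀ u ∈ redD, p u) (g : Gen) :
    p (gD g) := by
  cases g with
  | a => exact ha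
  | y => exact hr _ (redGen_mem Gen.y)
  | t => exact hr _ (redGen_mem Gen.t)
  | x => exact hr _ (redGen_mem Gen.x)

/-- The span contains `1` and is stable under left multiplication by the generators: for `a` because
`a u = u a + [a, u]` with `[a, u]` in `redD`. -/
lemma mem_span_mul_a_pow (x : D) :
    x ∈ hClosure (Submodule.span K {x | ∃ u ∈ redD, ∃ p : ℕ, x = u * gD Gen.a ^ p}) := by
  set N := Submodule.span K {x | ∃ u ∈ redD, ∃ p : ℕ, x = u * gD Gen.a ^ p}
  have hle : ∀ g, N ≤ N.comap (LinearMap.mulLeft K (gD g)) := by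
    refine gD_cases (p := fun z => N ≤ N.comap (LinearMap.mulLeft K z)) ?_ fun z hz => ?_
    all_goals
      refine Submodule.span_le.2 ?_
      rintro _ ⟨u, hu, p, rfl⟩
      rw [SetLike.mem_coe, Submodule.mem_comap, LinearMap.mulLeft_apply, ← mul_assoc]
    · have : gD Gen.a * u * gD Gen.a ^ p
          = u * gD Gen.a ^ (p + 1) + (gD Gen.a * u - u * gD Gen.a) * gD Gen.a ^ p := by
        rw [sub_mul, pow_succ', ← mul_assoc]
        abel
      rw [this]
      exact add_mem (Submodule.subset_span ⟨_, hu, _, rfl⟩)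
        (Submodule.subset_span ⟨_, commutator_a_mem_redD hu, _, rfl⟩)
    · exact Submodule.subset_span ⟨_, mul_mem hz hu, _, rfl⟩
  have key : ∀ x ∈ Algebra.adjoin K (Set.range gD), ∀ z ∈ N, x * z ∈ N := by
    intro x hx
    induction hx using Algebra.adjoin_induction with
    | mem x hx =>
      obtain ⟨g, rfl⟩ := hx
      exact fun z hz => hle g hz
    | algebraMap r =>
      intro z hz
      rw [← Algebra.smul_def]
      exact Submodule.smul_mem _ _ hz
    | add u w _ _ hu hw =>
      intro z hz
      rw [add_mul]
      exact add_mem (hu z hz) (hw z hz)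
    | mul u w _ _ hu hw =>
      intro z hz
      rw [mul_assoc]
      exact hu _ (hw z hz)
  refine map_mem_hClosure LinearMap.id (fun x hx => ?_) (mem_closedAdjoin_gD x)
  have := key x hx 1 (Submodule.subset_span ⟨1, one_mem _, 0, by simp⟩)
  rw [mul_one] at this
  exact le_hClosure N this

/-- The mirror image, with right multiplication. The powers of `a` stand on the left here since
`sandwich_comul_a_mul` removes `Δ(a)` from the left of the second argument. -/
lemma mem_span_a_pow_mul (x : D) :
    x ∈ hClosure (Submodule.span K {x | ∃ u ∈ redD, ∃ p : ℕ, x = gD Gen.a ^ p * u}) := by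
  set N := Submodule.span K {x | ∃ u ∈ redD, ∃ p : ℕ, x = gD Gen.a ^ p * u}
  have hle : ∀ g, N ≤ N.comap (LinearMap.mulRight K (gD g)) := by
    refine gD_cases (p := fun z => N ≤ N.comap (LinearMap.mulRight K z)) ?_ fun z hz => ?_
    all_goals
      refine Submodule.span_le.2 ?_
      rintro _ ⟨u, hu, p, rfl⟩
      rw [SetLike.mem_coe, Submodule.mem_comap, LinearMap.mulRight_apply, mul_assoc]
    · have : gD Gen.a ^ p * (u * gD Gen.a)
          = gD Gen.a ^ (p + 1) * u - gD Gen.a ^ p * (gD Gen.a * u - u * gD Gen.a) := by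
        rw [mul_sub, pow_succ, mul_assoc]
        abel
      rw [this]
      exact sub_mem (Submodule.subset_span ⟨_, hu, _, rfl⟩)
        (Submodule.subset_span ⟨_, commutator_a_mem_redD hu, _, rfl⟩)
    · exact Submodule.subset_span ⟨_, mul_mem hu hz, _, rfl⟩
  have key : ∀ x ∈ Algebra.adjoin K (Set.range gD), ∀ z ∈ N, z * x ∈ N := by
    intro x hx
    induction hx using Algebra.adjoin_induction with
    | mem x hx =>
      obtain ⟨g, rfl⟩ := hx
      exact fun z hz => hle g hz
    | algebraMap r =>
      intro z hz
      rw [← Algebra.commutes, ← Algebra.smul_def]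
      exact Submodule.smul_mem _ _ hz
    | add u w _ _ hu hw =>
      intro z hz
      rw [mul_add]
      exact add_mem (hu z hz) (hw z hz)
    | mul u w _ _ hu hw =>
      intro z hz
      rw [← mul_assoc]
      exact hw _ (hu z hz)
  refine map_mem_hClosure LinearMap.id (fun x hx => ?_) (mem_closedAdjoin_gD x)
  have := key x hx 1 (Submodule.subset_span ⟨1, one_mem _, 0, by simp⟩)
  rw [one_mul] at this
  exact le_hClosure N this

lemma bilinear_mem_redD (f : D →ₗ[K] D →ₗ[K] D) (H : ∀ u ∈ redD, ∀ w ∈ redD, ∀ p s : ℕ,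
    f (u * gD Gen.a ^ p) (gD Gen.a ^ s * w) ∈ redD) (x y : D) : f x y ∈ redD := by
  refine map_mem_hClosure_of_span (f.flip y) ?_ (mem_span_mul_a_pow x)
  rintro _ ⟨u, hu, p, rfl⟩
  refine map_mem_hClosure_of_span (f (u * gD Gen.a ^ p)) ?_ (mem_span_a_pow_mul y)
  rintro _ ⟨w, hw, s, rfl⟩
  exact H u hu w hw p s

lemma sandwich_comul_mem_redD (x y : D) : extendDD₂ sandwich (comul x) (comul y) ∈ redD := by
  refine bilinear_mem_redD ((extendDD₂ sandwich).compl₁₂ comul.toLinearMap comul.toLinearMap)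
    (fun u hu w hw p s => ?_) x y
  rw [LinearMap.compl₁₂_apply, AlgHom.toLinearMap_apply, AlgHom.toLinearMap_apply, map_mul comul,
    map_mul comul, map_pow comul, map_pow comul]
  exact sandwich_comul_a_pow_mem p s (comul_mem_redDD hu) (comul_mem_redDD hw)

/-- By continuity and linearity only pure tensors matter, as `redD` is closed. -/
lemma B_mem_redD (w : DD) : B w ∈ redD := by
  refine map_mem_hClosure B ?_ (mem_hClosure_range_of (M := D ⊗[K] D) w)
  rintro _ ⟨z, rfl⟩
  change B (toDD z) ∈ redD
  induction z using TensorProduct.induction_on with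
  | zero =>
    rw [map_zero, map_zero]
    exact zero_mem _
  | tmul x y =>
    rw [B_toDD]
    exact sandwich_comul_mem_redD x y
  | add z z' hz hz' =>
    rw [map_add, map_add]
    exact add_mem hz hz'

/-- On pure tensors `Th` is a product of values of `B`, and `redD` is a closed subalgebra. Nothing
about `Cr` enters, because `B_mem_redD` holds for every argument of `B`. -/
lemma Th_mem_redD (g : ℕ) (w : TP D (2 * g)) : Th g w ∈ redD := by
  refine map_mem_hClosure (Th g) ?_ (mem_hClosure_range_of w)
  rintro _ ⟨z, rfl⟩
  change Th g _ ∈ redD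
  induction z using PiTensorProduct.induction_on with
  | smul_tprod r u =>
    rw [map_smul, map_smul, Th_of]
    refine Subalgebra.smul_mem _ (list_prod_mem fun x hx => ?_) r
    obtain ⟨i, rfl⟩ := (List.mem_ofFn' _ _).1 hx
    exact B_mem_redD _
  | add z z' hz hz' =>
    rw [map_add, map_add]
    exact add_mem hz hz'

end Band

end BandMap

theorem mainTheorem4 :
    -- the ordered monomials are a topological basis of `𝔻`
    Function.Bijective BandMap.ord ∧
    -- every element of the image of `B` only has monomials with `p ≤ q`
    (∀ (w : BandMap.DD) (f : PowerSeries (MvPolynomial BandMap.Gen BandMap.Qe)),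
      BandMap.ord f = BandMap.B w → BandMap.Star f) ∧
    -- the spans of the excluded monomials meet the image of `B` trivially
    (∀ n j : ℕ, 1 ≤ j → ∀ w ∈ BandMap.badSpan n j, w ∈ LinearMap.range BandMap.B → w = 0) ∧
    -- the same two assertions for the thickening maps
    (∀ g : ℕ, 1 ≤ g → ∀ (w : BandMap.TP BandMap.D (2 * g))
      (f : PowerSeries (MvPolynomial BandMap.Gen BandMap.Qe)),
      BandMap.ord f = BandMap.Th g w → BandMap.Star f) ∧
    (∀ g : ℕ, 1 ≤ g → ∀ n j : ℕ, 1 ≤ j → ∀ w ∈ BandMap.badSpan n j,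
      w ∈ LinearMap.range (BandMap.Th g) → w = 0) := by
  refine ⟨⟨BandMap.ord_injective, BandMap.ord_surjective⟩, fun w f hf => ?_, ?_,
    fun g _ w f hf => ?_, ?_⟩
  · exact BandMap.star_of_mem_redD (hf ▸ BandMap.B_mem_redD w)
  · rintro n j hj _ hw ⟨u, rfl⟩
    exact BandMap.eq_zero_of_mem_badSpan hj hw (BandMap.B_mem_redD u)
  · exact BandMap.star_of_mem_redD (hf ▸ BandMap.Th_mem_redD g w)
  · rintro g _ n j hj _ hw ⟨u, rfl⟩
    exact BandMap.eq_zero_of_mem_badSpan hj hw (BandMap.Th_mem_redD g u)
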